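/- Let $\lambda_1,\lambda_2>0$ and $c_1>c_2>0$. Let $X_1(t)$ and $X_2(t)$, $t\ge 0$, be two independent Goldstein–Kac telegraph processes on $\mathbb R$ with speeds $c_1,c_2$ and rates $\lambda_1,\lambda_2$: $X_i$ starts at the origin at time $0$, its initial direction is positive or negative with probability $1/2$ each, it moves with constant speed $c_i$, and it reverses its direction at each event of a homogeneous Poisson process of rate $\lambda_i$ that is independent of the initial direction. Let $F(\xi,\eta;\zeta;z)=\sum_{s\ge0}\frac{(\xi)_s(\eta)_s}{(\zeta)_s}\frac{z^s}{s!}$ be the Gauss hypergeometric function, write $F_k(z)=F\left(-k,\tfrac12;\tfrac32;z\right)$, and let $I_0(z)=\sum_{k\ge0}\frac{1}{(k!)^2}\left(\frac z2\right)^{2k}$ and $I_1(z)=\sum_{k\ge0}\frac{1}{k!\,(k+1)!}\left(\frac z2\right)^{2k+1}$ be modified Bessel functions. Then for every $t>0$ and $r\in\mathbb R$ the distribution function $\Phi(r,t)=\Pr\{|X_1(t)-X_2(t)|<r\}$ is $$\Phi(r,t)=\begin{cases}0,& r\le 0,\\ G(r,t),& 0<r\le (c_1-c_2)t,\\ Q(r,t),&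 (c_1-c_2)t<r\le (c_1+c_2)t,\\ 1,& r>(c_1+c_2)t,\end{cases}$$ where $$G(r,t)=\frac{\lambda_1e^{-(\lambda_1+\lambda_2)t}}{2c_1}\sum_{k=0}^\infty\frac{1}{(k!)^2}\left(\frac{\lambda_1t}{2}\right)^{2k}\left(1+\frac{\lambda_1t}{2k+2}\right)\left[(c_2t+r)F_k\left(\frac{(c_2t+r)^2}{c_1^2t^2}\right)-(c_2t-r)F_k\left(\frac{(c_2t-r)^2}{c_1^2t^2}\right)\right]$$ $$\qquad+\frac{\lambda_1e^{-\lambda_1t}}{2c_1}\sum_{k=0}^\infty\frac{1}{(k!)^2}\left(\frac{\lambda_1t}{2}\right)^{2k}\left(1+\frac{\lambda_1t}{2k+2}\right)\mathcal I_k(r,t),$$ $$Q(r,t)=\frac12\left[(1-e^{-\lambda_1t})e^{-\lambda_2t}+(1-e^{-\lambda_2t})e^{-\lambda_1t}+e^{-(\lambda_1+\lambda_2)t}\right]$$ $$\qquad-\frac{\lambda_1(c_2t-r)e^{-(\lambda_1+\lambda_2)t}}{2c_1}\sum_{k=0}^\infty\frac{1}{(k!)^2}\left(\frac{\lambda_1t}{2}\right)^{2k}\left(1+\frac{\lambda_1t}{2k+2}\right)F_k\left(\frac{(c_2t-r)^2}{c_1^2t^2}\right)$$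 $$\qquad-\frac{\lambda_2(c_1t-r)e^{-(\lambda_1+\lambda_2)t}}{2c_2}\sum_{k=0}^\infty\frac{1}{(k!)^2}\left(\frac{\lambda_2t}{2}\right)^{2k}\left(1+\frac{\lambda_2t}{2k+2}\right)F_k\left(\frac{(c_1t-r)^2}{c_2^2t^2}\right)$$ $$\qquad+\frac{\lambda_1e^{-\lambda_1t}}{2c_1}\sum_{k=0}^\infty\frac{1}{(k!)^2}\left(\frac{\lambda_1t}{2}\right)^{2k}\left(1+\frac{\lambda_1t}{2k+2}\right)\mathcal I_k(r,t),$$ with $$\mathcal I_k(r,t)=\frac{\lambda_2e^{-\lambda_2t}}{2c_2}\int_{-c_2t}^{c_2t}\left[\beta F_k\left(\frac{\beta^2}{c_1^2t^2}\right)-\alpha F_k\left(\frac{\alpha^2}{c_1^2t^2}\right)\right]\left[I_0\left(\frac{\lambda_2}{c_2}\sqrt{c_2^2t^2-x^2}\right)+\frac{c_2t}{\sqrt{c_2^2t^2-x^2}}I_1\left(\frac{\lambda_2}{c_2}\sqrt{c_2^2t^2-x^2}\right)\right]dx,$$ $\alpha=\alpha(x,r)=\max\{-c_1t,\,x-r\}$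 and $\beta=\beta(x,r)=\min\{c_1t,\,x+r\}$. In the stated ranges of $r$ all the series converge and the integrands of $\mathcal I_k(r,t)$ are integrable. -/

import Mathlib

open MeasureTheory ProbabilityTheory
open scoped NNReal Nat

noncomputable section

namespace Telegraph

/-- `N` is a homogeneous Poisson process of rate `lam` under `P`: a counting process started at `0`,
almost surely with nondecreasing right-continuous paths (`ℕ` is discrete), with independent
increments, the increment over `[s, t]` being Poisson distributed with mean `lam * (t - s)`.
As the paths are nondecreasing, the truncated subtraction in `ℕ` is the true increment. -/
structure IsPoissonProcess {Ω : Type*} [MeasurableSpace Ω] (P : Measure Ω) (lam : ℝ≥0)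
    (N : ℝ≥0 → Ω → ℕ) : Prop where
  measurable : ∀ t, Measurable (N t)
  start_zero : ∀ᵐ ω ∂P, N 0 ω = 0
  monotone_path : ∀ᵐ ω ∂P, Monotone fun t ↦ N t ω
  rightContinuous_path :
    ∀ᵐ ω ∂P, ∀ t, ContinuousWithinAt (fun u ↦ N u ω) (Set.Ici t) t
  indepIncrements : HasIndepIncrements N P
  increment_law : ∀ s t, s ≤ t →
    HasLaw (fun ω ↦ N t ω - N s ω) (poissonMeasure (lam * (t - s))) P

/-- `X` is a Goldstein-Kac telegraph process of speed `c` and rate `lam`, started at the origin: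
there are an initial direction `D`, equal to `1` or `-1` with probability `1/2` each, and an
independent Poisson process `N` of rate `lam`, such that the velocity at time `s` is
`c * D * (-1) ^ N s`, that is, the direction is reversed at each Poisson event. -/
def IsTelegraphProcess {Ω : Type*} [MeasurableSpace Ω] (P : Measure Ω) (c : ℝ) (lam : ℝ≥0)
    (X : ℝ≥0 → Ω → ℝ) : Prop :=
  ∃ (D : Ω → ℝ) (N : ℝ≥0 → Ω → ℕ),
    Measurable D ∧ P {ω | D ω = 1} = 1 / 2 ∧ P {ω | D ω = -1} = 1 / 2 ∧
    IsPoissonProcess P lam N ∧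
    IndepFun D (fun ω s ↦ N s ω) P ∧
    ∀ᵐ ω ∂P, ∀ t : ℝ≥0,
      X t ω = ∫ s in (0 : ℝ)..(t : ℝ), c * D ω * (-1) ^ N s.toNNReal ω

/-- The distribution function `r ↦ Pr {|X₁(t) - X₂(t)| < r}` of the distance at time `t`. -/
def distanceDF {Ω : Type*} [MeasurableSpace Ω] (P : Measure Ω) (X₁ X₂ : ℝ≥0 → Ω → ℝ)
    (r : ℝ) (t : ℝ≥0) : ℝ :=
  P.real {ω | |X₁ t ω - X₂ t ω| < r}

/-- The modified Bessel function `I_n` of integer order `n ≥ 0`. -/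
def besselI (n : ℕ) (z : ℝ) : ℝ :=
  ∑' k : ℕ, 1 / ((k ! : ℝ) * ((k + n)! : ℝ)) * (z / 2) ^ (2 * k + n)

/-- The Gauss hypergeometric function `F(-k, 1/2; 3/2; z)`. -/
def hypF (k : ℕ) (z : ℝ) : ℝ := ₂F₁ (-(k : ℝ)) (1 / 2 : ℝ) (3 / 2 : ℝ) z

/-- The common coefficient `(1 / (k!)²) (lam t / 2)^(2k) (1 + lam t / (2k + 2))`. -/
def coeff (lam t : ℝ) (k : ℕ) : ℝ :=
  1 / (k ! : ℝ) ^ 2 * (lam * t / 2) ^ (2 * k) * (1 + lam * t / (2 * k + 2))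

/-- `α(x, r) = max {-c₁ t, x - r}`. -/
def alpha (c₁ t x r : ℝ) : ℝ := max (-(c₁ * t)) (x - r)

/-- `β(x, r) = min {c₁ t, x + r}`. -/
def beta (c₁ t x r : ℝ) : ℝ := min (c₁ * t) (x + r)

/-- The integrand of the integral term `I_k(r, t)`. -/
def integrandI (c₁ c₂ lam₂ : ℝ) (k : ℕ) (r t x : ℝ) : ℝ :=
  (beta c₁ t x r * hypF k (beta c₁ t x r ^ 2 / (c₁ ^ 2 * t ^ 2))
      - alpha c₁ t x r * hypF k (alpha c₁ t x r ^ 2 / (c₁ ^ 2 * t ^ 2)))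
    * (besselI 0 (lam₂ / c₂ * √(c₂ ^ 2 * t ^ 2 - x ^ 2))
      + c₂ * t / √(c₂ ^ 2 * t ^ 2 - x ^ 2)
        * besselI 1 (lam₂ / c₂ * √(c₂ ^ 2 * t ^ 2 - x ^ 2)))

/-- The integral term `I_k(r, t)`. -/
def integralI (c₁ c₂ lam₂ : ℝ) (k : ℕ) (r t : ℝ) : ℝ :=
  lam₂ * Real.exp (-(lam₂ * t)) / (2 * c₂)
    * ∫ x in (-(c₂ * t))..(c₂ * t), integrandI c₁ c₂ lam₂ k r t x

/-- The terms of the series with the integral factors. -/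
def termI (c₁ c₂ lam₁ lam₂ r t : ℝ) (k : ℕ) : ℝ :=
  coeff lam₁ t k * integralI c₁ c₂ lam₂ k r t

/-- The terms of the first series of `G`. -/
def termG (c₁ c₂ lam₁ r t : ℝ) (k : ℕ) : ℝ :=
  coeff lam₁ t k
    * ((c₂ * t + r) * hypF k ((c₂ * t + r) ^ 2 / (c₁ ^ 2 * t ^ 2))
      - (c₂ * t - r) * hypF k ((c₂ * t - r) ^ 2 / (c₁ ^ 2 * t ^ 2)))

/-- The function `G(r, t)`. -/
def G (c₁ c₂ lam₁ lam₂ r t : ℝ) : ℝ :=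
  lam₁ * Real.exp (-((lam₁ + lam₂) * t)) / (2 * c₁) * ∑' k : ℕ, termG c₁ c₂ lam₁ r t k
  + lam₁ * Real.exp (-(lam₁ * t)) / (2 * c₁) * ∑' k : ℕ, termI c₁ c₂ lam₁ lam₂ r t k

/-- The terms of the single series of `Q`: for the pair `(a, b)` of speeds and the rate `lam`,
the coefficient times `F(-k, 1/2; 3/2; (b t - r)² / (a² t²))`. -/
def termQ (a b lam r t : ℝ) (k : ℕ) : ℝ :=
  coeff lam t k * hypF k ((b * t - r) ^ 2 / (a ^ 2 * t ^ 2))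

/-- The function `Q(r, t)`. -/
def Q (c₁ c₂ lam₁ lam₂ r t : ℝ) : ℝ :=
  1 / 2 * ((1 - Real.exp (-(lam₁ * t))) * Real.exp (-(lam₂ * t))
    + (1 - Real.exp (-(lam₂ * t))) * Real.exp (-(lam₁ * t))
    + Real.exp (-((lam₁ + lam₂) * t)))
  - lam₁ * (c₂ * t - r) * Real.exp (-((lam₁ + lam₂) * t)) / (2 * c₁)
    * ∑' k : ℕ, termQ c₁ c₂ lam₁ r t k
  - lam₂ * (c₁ * t - r) * Real.exp (-((lam₁ + lam₂) * t)) / (2 * c₂)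
    * ∑' k : ℕ, termQ c₂ c₁ lam₂ r t k
  + lam₁ * Real.exp (-(lam₁ * t)) / (2 * c₁) * ∑' k : ℕ, termI c₁ c₂ lam₁ lam₂ r t k

end Telegraph

end

namespace Telegraph

open Set Filter Topology

/-! By independence and Fubini, the distance distribution is the integral, against the law of X₂(t),
of the mass that the law of X₁(t) gives to (y - r, y + r) (`distanceDF_eq_integral`). So everything
rests on the law of one telegraph process at a fixed time: two atoms of mass e^{-λt}/2 at ±ct, and a
Bessel density between them.

That law is identified through its moment generating function. Let Y be the position for unit speed
and positive initial direction, and ε = (-1)^N its velocity. Since the increments of N after time s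
are independent of the path up to s, E[ε_u e^{θY_s}] = e^{-2λ(u-s)} E[ε_s e^{θY_s}] for s ≤ u
(`integral_later_sign_mul`). Hence the pair E e^{θY}, E[ε e^{θY}] solves u' = θv, v' = θu - 2λv,
whose solution is hyperbolic (`posMgf_eq`); averaging over the initial direction gives `mgf_eq`. On
the other side, the transform of the explicit density comes from a double power series regrouped by
total degree (`integral_densitySeries_mul_cosh`). The two transforms agree, and bounded support
makes them determine the law (`map_eq_law`).

The hypergeometric polynomials enter because x F_k(x²/q) is the primitive of (1 - x²/q)^k vanishing
at 0, and the density is a series in these powers. Splitting both laws into atoms and density then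
yields the formulas. For r ≤ (c₁ - c₂)t the atoms of X₁(t) are out of reach of X₂(t), which gives G.
For larger r an atom of one process is seen from the nearby end of the range of the other, and the
integrals are tails; writing a tail as half the continuous mass minus an integral from 0 produces
the exponential constant of Q. -/

/-- The sign `(-1) ^ n s` along a counting path. -/
noncomputable def pathSign (n : ℝ≥0 → ℕ) (s : ℝ) : ℝ := (-1) ^ n s.toNNReal

/-- The position at time `t` of a particle of unit speed which starts in the positive direction and
turns at each jump of the counting path `n`. -/
noncomputable def pathPos (n : ℝ≥0 → ℕ) (t : ℝ) : ℝ := ∫ s in (0 : ℝ)..t, pathSign n s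

/-! ### Deterministic paths and their Riemann sums -/

section Path

variable {n : ℝ≥0 → ℕ}

lemma abs_pathSign (n : ℝ≥0 → ℕ) (s : ℝ) : |pathSign n s| = 1 := by
  simp [pathSign, abs_pow]

lemma pathSign_mul_self (n : ℝ≥0 → ℕ) (s : ℝ) : pathSign n s * pathSign n s = 1 := by
  rw [← abs_mul_abs_self, abs_pathSign, one_mul]

lemma measurable_pathSign (hn : Monotone n) : Measurable (pathSign n) := by
  have h : Monotone fun s : ℝ ↦ n s.toNNReal := hn.comp fun a b h ↦ Real.toNNReal_mono h
  exact (Measurable.of_discrete (f := fun k : ℕ ↦ (-1 : ℝ) ^ k)).comp h.measurable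

lemma intervalIntegrable_pathSign (hn : Monotone n) (a b : ℝ) :
    IntervalIntegrable (pathSign n) volume a b := by
  refine (intervalIntegrable_const (c := (1 : ℝ))).mono_fun
    (measurable_pathSign hn).aestronglyMeasurable ?_
  exact .of_forall fun s ↦ by simp [abs_pathSign]

lemma pathPos_sub (hn : Monotone n) (s t : ℝ) :
    pathPos n t - pathPos n s = ∫ x in s..t, pathSign n x :=
  intervalIntegral.integral_interval_sub_left (intervalIntegrable_pathSign hn _ _)
    (intervalIntegrable_pathSign hn _ _)

lemma abs_pathPos_sub_le (hn : Monotone n) (s t : ℝ) :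
    |pathPos n t - pathPos n s| ≤ |t - s| := by
  rw [pathPos_sub hn]
  simpa using intervalIntegral.norm_integral_le_of_norm_le_const (C := 1) (a := s) (b := t)
    (f := pathSign n) fun x _ ↦ by simp [abs_pathSign]

lemma abs_pathPos_le (n : ℝ≥0 → ℕ) (t : ℝ) : |pathPos n t| ≤ |t| := by
  simpa [pathPos] using intervalIntegral.norm_integral_le_of_norm_le_const (C := 1) (a := 0) (b := t)
    (f := pathSign n) fun x _ ↦ by simp [abs_pathSign]

lemma continuousWithinAt_pathSign (hr : ∀ t, ContinuousWithinAt n (Ici t) t) (t : ℝ) :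
    ContinuousWithinAt (pathSign n) (Ici t) t := by
  have h1 : ContinuousWithinAt (fun s : ℝ ↦ n s.toNNReal) (Ici t) t :=
    (hr t.toNNReal).comp continuous_real_toNNReal.continuousWithinAt
      fun s hs ↦ Real.toNNReal_mono hs
  exact (continuous_of_discreteTopology (f := fun k : ℕ ↦ (-1 : ℝ) ^ k)).continuousAt
    |>.comp_continuousWithinAt h1

lemma hasDerivWithinAt_pathPos (hn : Monotone n) (hr : ∀ t, ContinuousWithinAt n (Ici t) t)
    (t : ℝ) : HasDerivWithinAt (pathPos n) (pathSign n t) (Ici t) t :=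
  intervalIntegral.integral_hasDerivWithinAt_right (intervalIntegrable_pathSign hn _ _)
    (measurable_pathSign hn).stronglyMeasurable.stronglyMeasurableAtFilter
    ((continuousWithinAt_pathSign hr t).mono Ioi_subset_Ici_self)

lemma abs_neg_one_pow_sub_le {a b : ℕ} (h : a ≤ b) :
    |(-1 : ℝ) ^ a - (-1) ^ b| ≤ 2 * ((b : ℝ) - a) := by
  obtain rfl | h := h.eq_or_lt
  · simp
  · have h1 : (a : ℝ) + 1 ≤ b := by exact_mod_cast h
    have h2 := abs_sub ((-1 : ℝ) ^ a) ((-1) ^ b)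
    simp only [abs_pow, abs_neg, abs_one, one_pow] at h2
    linarith

/-- The Riemann sum of `pathSign n` over `[0, t]` with `m` steps and right end points. -/
noncomputable def riemannSum (n : ℝ≥0 → ℕ) (t : ℝ≥0) (m : ℕ) : ℝ :=
  ∑ i ∈ Finset.range m, (t / m : ℝ) * (-1) ^ n ((i + 1 : ℕ) * t / m)

/-- On each step the sign differs from its right end value by at most twice the increment of `n`,
and the increments telescope. Riemann sums are needed because they depend on finitely many values of
the path, so that independence and measurability for the product σ-algebra apply to them. -/
lemma abs_pathPos_sub_riemannSum_le (hn : Monotone n) (t : ℝ≥0) {m : ℕ} (hm : 0 < m) :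
    |pathPos n t - riemannSum n t m| ≤ 2 * (n t : ℝ) * t / m := by
  have hm' : (0 : ℝ) < m := by exact_mod_cast hm
  set τ : ℕ → ℝ≥0 := fun i ↦ i * t / m with hτ
  have hτm : Monotone τ := fun i j hij ↦ by
    simp only [hτ]; gcongr
  have hstep (i : ℕ) : ((τ (i + 1) : ℝ≥0) : ℝ) - τ i = t / m := by
    simp only [hτ]; push_cast; field_simp; ring
  have h1 : pathPos n t = ∑ i ∈ Finset.range m, ∫ s in (τ i : ℝ)..τ (i + 1), pathSign n s := by
    rw [intervalIntegral.sum_integral_adjacent_intervals fun k _ ↦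
      intervalIntegrable_pathSign hn _ _]
    have : (m : ℝ≥0) ≠ 0 := by exact_mod_cast hm.ne'
    simp [hτ, pathPos, this]
  have h2 (i : ℕ) : |(∫ s in (τ i : ℝ)..τ (i + 1), pathSign n s)
      - (t / m : ℝ) * (-1) ^ n (τ (i + 1))| ≤ 2 * ((n (τ (i + 1)) : ℝ) - n (τ i)) * (t / m) := by
    have hc : (t / m : ℝ) * (-1) ^ n (τ (i + 1))
        = ∫ _ in (τ i : ℝ)..τ (i + 1), ((-1 : ℝ) ^ n (τ (i + 1))) := by
      rw [intervalIntegral.integral_const, hstep, smul_eq_mul]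
    rw [hc, ← intervalIntegral.integral_sub (intervalIntegrable_pathSign hn _ _)
      intervalIntegrable_const]
    have hle : (τ i : ℝ) ≤ τ (i + 1) := by exact_mod_cast hτm (Nat.le_succ i)
    have := intervalIntegral.norm_integral_le_of_norm_le_const (a := (τ i : ℝ))
      (b := τ (i + 1)) (f := fun s ↦ pathSign n s - (-1 : ℝ) ^ n (τ (i + 1)))
      (C := 2 * ((n (τ (i + 1)) : ℝ) - n (τ i))) fun s hs ↦ by
        rw [uIoc_of_le hle] at hs
        have hs0 : 0 ≤ s := (τ i).2.trans hs.1.le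
        have ha : n s.toNNReal ≤ n (τ (i + 1)) :=
          hn (Real.toNNReal_le_iff_le_coe.2 hs.2)
        have hb : (n (τ i) : ℝ) ≤ n s.toNNReal := by
          exact_mod_cast hn (NNReal.le_toNNReal_of_coe_le hs.1.le)
        refine (abs_neg_one_pow_sub_le ha).trans ?_
        linarith
    rwa [hstep, abs_of_nonneg (by positivity), Real.norm_eq_abs] at this
  have h3 : riemannSum n t m = ∑ i ∈ Finset.range m, (t / m : ℝ) * (-1) ^ n (τ (i + 1)) := rfl
  rw [h1, h3, ← Finset.sum_sub_distrib]
  refine (Finset.abs_sum_le_sum_abs _ _).trans ((Finset.sum_le_sum fun i _ ↦ h2 i).trans ?_)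
  rw [← Finset.sum_mul, ← Finset.mul_sum, Finset.sum_range_sub (fun i ↦ (n (τ i) : ℝ))]
  have h4 : τ m = t := by
    have : (m : ℝ≥0) ≠ 0 := by exact_mod_cast hm.ne'
    simp [hτ, this]
  rw [h4, mul_div_assoc]
  gcongr
  simp

lemma tendsto_riemannSum (hn : Monotone n) (t : ℝ≥0) :
    Tendsto (riemannSum n t) atTop (𝓝 (pathPos n t)) := by
  rw [tendsto_iff_norm_sub_tendsto_zero]
  refine squeeze_zero' (.of_forall fun m : ℕ ↦ norm_nonneg (riemannSum n t m - pathPos n t))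
    (g := fun m : ℕ ↦ 2 * (n t : ℝ) * t / m) ?_ ?_
  · filter_upwards [eventually_gt_atTop 0] with m hm
    rw [Real.norm_eq_abs, abs_sub_comm]
    exact abs_pathPos_sub_riemannSum_le hn t hm
  · exact tendsto_const_div_atTop_nhds_zero_nat _

lemma abs_riemannSum_le (n : ℝ≥0 → ℕ) (t : ℝ≥0) (m : ℕ) : |riemannSum n t m| ≤ t := by
  refine (Finset.abs_sum_le_sum_abs _ _).trans ?_
  simp only [abs_mul, abs_pow, abs_neg, abs_one, one_pow, mul_one, Finset.sum_const,
    Finset.card_range, nsmul_eq_mul]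
  rw [abs_of_nonneg (by positivity)]
  rcases Nat.eq_zero_or_pos m with rfl | hm
  · simp
  · have hm' : (m : ℝ) ≠ 0 := by exact_mod_cast hm.ne'
    rw [mul_div_cancel₀ _ hm']

end Path

lemma abs_exp_sub_exp_le {θ T a b : ℝ} (ha : |a| ≤ T) (hb : |b| ≤ T) :
    |Real.exp (θ * a) - Real.exp (θ * b)| ≤ |θ| * Real.exp (|θ| * T) * |a - b| := by
  have h := (convex_Icc (-T) T).norm_image_sub_le_of_norm_hasDerivWithin_le
    (f := fun x ↦ Real.exp (θ * x)) (f' := fun x ↦ Real.exp (θ * x) * θ)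
    (C := |θ| * Real.exp (|θ| * T))
    (fun x _ ↦ by
      simpa using (((hasDerivAt_id x).const_mul θ).exp).hasDerivWithinAt)
    (fun x hx ↦ by
      rw [norm_mul, mul_comm, Real.norm_eq_abs, Real.norm_eq_abs, Real.abs_exp]
      refine mul_le_mul_of_nonneg_left (Real.exp_le_exp.2 ?_) (abs_nonneg _)
      calc θ * x ≤ |θ * x| := le_abs_self _
        _ = |θ| * |x| := abs_mul _ _
        _ ≤ |θ| * T := by gcongr; exact abs_le.2 hx)
    (abs_le.1 hb) (abs_le.1 ha)
  simpa using h

lemma exp_mul_le_of_abs_le {θ T a : ℝ} (ha : |a| ≤ T) :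
    Real.exp (θ * a) ≤ Real.exp (|θ| * T) := by
  refine Real.exp_le_exp.2 ?_
  calc θ * a ≤ |θ * a| := le_abs_self _
    _ = |θ| * |a| := abs_mul _ _
    _ ≤ |θ| * T := by gcongr

/-! ### Independence of later increments from the past position -/

section Poisson

variable {Ω : Type*} [MeasurableSpace Ω] {P : Measure Ω} {lam : ℝ≥0}
  {N : ℝ≥0 → Ω → ℕ}

lemma measurable_riemannSum (hN : ∀ t, Measurable (N t)) (t : ℝ≥0) (m : ℕ) :
    Measurable fun ω ↦ riemannSum (fun s ↦ N s ω) t m := by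
  have h (s : ℝ≥0) : Measurable fun ω ↦ (-1 : ℝ) ^ N s ω :=
    (Measurable.of_discrete (f := fun k : ℕ ↦ (-1 : ℝ) ^ k)).comp (hN s)
  exact Finset.measurable_sum _ fun i _ ↦ (h _).const_mul _

namespace IsPoissonProcess

lemma measurable_neg_one_pow (hN : IsPoissonProcess P lam N) (t : ℝ≥0) :
    Measurable fun ω ↦ (-1 : ℝ) ^ N t ω :=
  (Measurable.of_discrete (f := fun k : ℕ ↦ (-1 : ℝ) ^ k)).comp (hN.measurable t)

lemma tendsto_riemannSum (hN : IsPoissonProcess P lam N) (t : ℝ≥0) :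
    ∀ᵐ ω ∂P, Tendsto (riemannSum (fun s ↦ N s ω) t) atTop (𝓝 (pathPos (fun s ↦ N s ω) t)) := by
  filter_upwards [hN.monotone_path] with ω hω using Telegraph.tendsto_riemannSum hω t

lemma aemeasurable_pathPos (hN : IsPoissonProcess P lam N) {t : ℝ} (ht : 0 ≤ t) :
    AEMeasurable (fun ω ↦ pathPos (fun s ↦ N s ω) t) P := by
  lift t to ℝ≥0 using ht
  exact aemeasurable_of_tendsto_metrizable_ae atTop
    (fun m ↦ (measurable_riemannSum hN.measurable t m).aemeasurable) (hN.tendsto_riemannSum t)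

lemma integral_neg_one_pow_increment (hN : IsPoissonProcess P lam N) {s u : ℝ≥0} (h : s ≤ u) :
    ∫ ω, (-1 : ℝ) ^ (N u ω - N s ω) ∂P = Real.exp (-(2 * lam * (u - s))) := by
  have h1 := (hN.increment_law s u h).integral_comp (f := fun k : ℕ ↦ (-1 : ℝ) ^ k)
    (Measurable.of_discrete).aestronglyMeasurable
  simp only [Function.comp_def] at h1
  rw [h1, integral_poissonMeasure]
  set r : ℝ≥0 := lam * (u - s) with hr
  have hr' : (r : ℝ) = lam * (u - s) := by simp [hr, NNReal.coe_sub h]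
  have h2 : ∀ n : ℕ, (Real.exp (-r) * r ^ n / n !) • (-1 : ℝ) ^ n
      = Real.exp (-r) * ((-(r : ℝ)) ^ n / n !) := fun n ↦ by
    rw [neg_pow (r : ℝ) n, smul_eq_mul]; ring
  have h3 : HasSum (fun n : ℕ ↦ (-(r : ℝ)) ^ n / n !) (Real.exp (-r)) := by
    rw [Real.exp_eq_exp_ℝ]; exact NormedSpace.expSeries_div_hasSum_exp _
  simp_rw [h2]
  rw [(h3.mul_left _).tsum_eq, ← Real.exp_add, hr']
  ring_nf

/-- (-1)^{N_u} = (-1)^{N_s} (-1)^{N_u - N_s}, and the last factor is independent of the increments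
on the grid of [0, s], which determine both N_s and the Riemann sum. -/
lemma integral_increment_mul_riemannSum [IsProbabilityMeasure P]
    (hN : IsPoissonProcess P lam N) {s u : ℝ≥0} (h : s ≤ u)
    (θ : ℝ) {m : ℕ} (hm : 0 < m) :
    ∫ ω, (-1 : ℝ) ^ N u ω * Real.exp (θ * riemannSum (fun x ↦ N x ω) s m) ∂P
      = Real.exp (-(2 * lam * (u - s)))
        * ∫ ω, (-1 : ℝ) ^ N s ω * Real.exp (θ * riemannSum (fun x ↦ N x ω) s m) ∂P := by
  have hm0 : (m : ℝ≥0) ≠ 0 := by exact_mod_cast hm.ne'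
  -- The m + 1 grid points of [0, s], followed by u: increment number m is then N_u - N_s, and the
  -- increments before it live on [0, s].
  set τ : ℕ → ℝ≥0 := fun i ↦ if i ≤ m then i * s / m else u with hτ
  have hτ_le {i : ℕ} (hi : i ≤ m) : τ i = i * s / m := if_pos hi
  have hτm : τ m = s := by rw [hτ_le le_rfl]; field_simp
  have hτm1 : τ (m + 1) = u := by simp [hτ]
  have hmono : Monotone τ := by
    intro i j hij
    by_cases hj : j ≤ m
    · rw [hτ_le hj, hτ_le (hij.trans hj)]; gcongr
    · by_cases hi : i ≤ m
      · rw [hτ_le hi, show τ j = u from if_neg hj]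
        refine le_trans ?_ h
        rw [div_le_iff₀ (by positivity), mul_comm]
        gcongr
      · rw [show τ j = u from if_neg hj, show τ i = u from if_neg hi]
  have hind := hN.indepIncrements.nat hmono
  have hmeas (i : ℕ) : Measurable fun ω ↦ N (τ (i + 1)) ω - N (τ i) ω :=
    (hN.measurable _).sub (hN.measurable _)
  have hpair := hind.indepFun_finset (Finset.range m) {m} (by simp) hmeas
  -- `K v i` rebuilds N at the i-th grid point from the increments `v`. This is true only almost
  -- surely: it uses N_0 = 0 and the monotonicity that makes truncated differences telescope.
  let K : (Finset.range m → ℕ) → ℕ → ℕ := fun v i ↦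
    ∑ j : Finset.range m, if (j : ℕ) < i then v j else 0
  let F₁ : (Finset.range m → ℕ) → ℝ := fun v ↦ (-1) ^ K v m
    * Real.exp (θ * ∑ i ∈ Finset.range m, (s / m : ℝ) * (-1) ^ K v (i + 1))
  let F₂ : (({m} : Finset ℕ) → ℕ) → ℝ := fun v ↦ (-1) ^ v ⟨m, by simp⟩
  have hcomp := hpair.comp (Measurable.of_discrete (f := F₁)) (Measurable.of_discrete (f := F₂))
  have hv : Measurable fun ω (i : Finset.range m) ↦ N (τ (i + 1)) ω - N (τ i) ω :=
    measurable_pi_lambda _ fun i ↦ hmeas i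
  have hv' : Measurable fun ω (i : ({m} : Finset ℕ)) ↦ N (τ (i + 1)) ω - N (τ i) ω :=
    measurable_pi_lambda _ fun i ↦ hmeas i
  have hmul := hcomp.integral_fun_mul_eq_mul_integral
    ((Measurable.of_discrete (f := F₁)).comp hv).aestronglyMeasurable
    ((Measurable.of_discrete (f := F₂)).comp hv').aestronglyMeasurable
  have hK : ∀ᵐ ω ∂P, ∀ i ≤ m,
      K (fun j ↦ N (τ (j + 1)) ω - N (τ j) ω) i = N (τ i) ω := by
    filter_upwards [hN.monotone_path, hN.start_zero] with ω hω h0 i hi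
    have h1 : Monotone fun j ↦ N (τ j) ω := fun a b hab ↦ hω (hmono hab)
    have h2 := Finset.sum_range_tsub h1 i
    have h3 : N (τ 0) ω = 0 := by rw [hτ_le (Nat.zero_le m)]; simpa using h0
    simp only [h3, tsub_zero] at h2
    rw [← h2]
    simp only [K]
    rw [Finset.sum_coe_sort (Finset.range m)
      (fun j ↦ if j < i then N (τ (j + 1)) ω - N (τ j) ω else 0), ← Finset.sum_filter]
    congr 1
    ext j
    simp only [Finset.mem_filter, Finset.mem_range]
    omega
  have hF₁ : ∀ᵐ ω ∂P, F₁ (fun j ↦ N (τ (j + 1)) ω - N (τ j) ω)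
      = (-1 : ℝ) ^ N s ω * Real.exp (θ * riemannSum (fun x ↦ N x ω) s m) := by
    filter_upwards [hK] with ω hω
    simp only [F₁, riemannSum]
    rw [hω m le_rfl, hτm]
    congr 3
    refine Finset.sum_congr rfl fun i hi ↦ ?_
    rw [hω (i + 1) (Finset.mem_range.1 hi), hτ_le (Finset.mem_range.1 hi)]
  have hF₂ : ∀ ω, F₂ (fun j ↦ N (τ (j + 1)) ω - N (τ j) ω) = (-1) ^ (N u ω - N s ω) := fun ω ↦ by
    simp only [F₂, hτm, hτm1]
  have e1 : ∫ ω, (-1 : ℝ) ^ N s ω * Real.exp (θ * riemannSum (fun x ↦ N x ω) s m) ∂P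
      = ∫ ω, F₁ (fun j ↦ N (τ (j + 1)) ω - N (τ j) ω) ∂P :=
    integral_congr_ae (hF₁.mono fun ω hω ↦ hω.symm)
  rw [← hN.integral_neg_one_pow_increment h, e1, mul_comm]
  simp only [Function.comp_def, hF₂] at hmul
  rw [← hmul]
  refine integral_congr_ae ?_
  filter_upwards [hF₁, hN.monotone_path] with ω hω hmon
  rw [hω]
  have h4 : N u ω = N s ω + (N u ω - N s ω) := (Nat.add_sub_cancel' (hmon h)).symm
  conv_lhs => rw [h4, pow_add]
  ring

lemma integral_later_sign_mul [IsProbabilityMeasure P]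
    (hN : IsPoissonProcess P lam N) {s u : ℝ≥0} (h : s ≤ u) (θ : ℝ) :
    ∫ ω, (-1 : ℝ) ^ N u ω * Real.exp (θ * pathPos (fun x ↦ N x ω) s) ∂P
      = Real.exp (-(2 * lam * (u - s)))
        * ∫ ω, (-1 : ℝ) ^ N s ω * Real.exp (θ * pathPos (fun x ↦ N x ω) s) ∂P := by
  have key (v : ℝ≥0) : Tendsto
      (fun m ↦ ∫ ω, (-1 : ℝ) ^ N v ω * Real.exp (θ * riemannSum (fun x ↦ N x ω) s m) ∂P) atTop
      (𝓝 (∫ ω, (-1 : ℝ) ^ N v ω * Real.exp (θ * pathPos (fun x ↦ N x ω) s) ∂P)) := by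
    refine tendsto_integral_of_dominated_convergence (fun _ ↦ Real.exp (|θ| * s)) (fun m ↦ ?_)
      (integrable_const _) (fun m ↦ .of_forall fun ω ↦ ?_) ?_
    · exact ((hN.measurable_neg_one_pow v).mul
        ((measurable_riemannSum hN.measurable s m).const_mul θ).exp).aestronglyMeasurable
    · simpa [abs_mul] using exp_mul_le_of_abs_le (abs_riemannSum_le (fun x ↦ N x ω) s m)
    · filter_upwards [hN.tendsto_riemannSum s] with ω hω
      exact ((Real.continuous_exp.tendsto _).comp (hω.const_mul θ)).const_mul _
  refine tendsto_nhds_unique (key u) (((key s).const_mul _).congr' ?_)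
  filter_upwards [eventually_gt_atTop 0] with m hm
  exact (hN.integral_increment_mul_riemannSum h θ hm).symm

end IsPoissonProcess

end Poisson

/-! ### The linear system for the moment generating functions -/

section Transform

variable {Ω : Type*} [MeasurableSpace Ω] {P : Measure Ω} {lam : ℝ≥0} {N : ℝ≥0 → Ω → ℕ}

/-- The moment generating function at `θ` of the position at time `t`. -/
noncomputable def posMgf (P : Measure Ω) (N : ℝ≥0 → Ω → ℕ) (θ t : ℝ) : ℝ :=
  ∫ ω, Real.exp (θ * pathPos (fun x ↦ N x ω) t) ∂P

/-- The moment generating function at `θ` of the position at time `t`, weighted by the direction. -/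
noncomputable def signedMgf (P : Measure Ω) (N : ℝ≥0 → Ω → ℕ) (θ t : ℝ) : ℝ :=
  ∫ ω, pathSign (fun x ↦ N x ω) t * Real.exp (θ * pathPos (fun x ↦ N x ω) t) ∂P

namespace IsPoissonProcess

lemma measurable_pathSign (hN : IsPoissonProcess P lam N) (t : ℝ) :
    Measurable fun ω ↦ pathSign (fun x ↦ N x ω) t :=
  hN.measurable_neg_one_pow _

lemma aestronglyMeasurable_exp (hN : IsPoissonProcess P lam N) (θ : ℝ) {t : ℝ} (ht : 0 ≤ t) :
    AEStronglyMeasurable (fun ω ↦ Real.exp (θ * pathPos (fun x ↦ N x ω) t)) P :=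
  (Real.measurable_exp.comp_aemeasurable
    ((hN.aemeasurable_pathPos ht).const_mul θ)).aestronglyMeasurable

lemma integrable_mul_exp [IsFiniteMeasure P] (hN : IsPoissonProcess P lam N) {A : Ω → ℝ}
    (hA : Measurable A) (hA1 : ∀ ω, |A ω| ≤ 1) (θ : ℝ) {t : ℝ} (ht : 0 ≤ t) :
    Integrable (fun ω ↦ A ω * Real.exp (θ * pathPos (fun x ↦ N x ω) t)) P := by
  refine .of_bound (hA.aestronglyMeasurable.mul (hN.aestronglyMeasurable_exp θ ht))
    (1 * Real.exp (|θ| * |t|)) (.of_forall fun ω ↦ ?_)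
  rw [norm_mul, Real.norm_eq_abs, Real.norm_eq_abs, Real.abs_exp]
  exact mul_le_mul (hA1 ω) (exp_mul_le_of_abs_le (abs_pathPos_le _ _)) (Real.exp_pos _).le
    zero_le_one

/-- Dominated convergence for the difference quotient of e^{θY}, bounded because Y is 1-Lipschitz
and bounded on bounded times. The weight may move with s: it is 1 for `posMgf` and the current sign
for `signedMgf`. -/
lemma tendsto_integral_slope [IsFiniteMeasure P] (hN : IsPoissonProcess P lam N)
    {A : ℝ → Ω → ℝ} (hA : ∀ s, Measurable (A s)) (hA1 : ∀ s ω, |A s ω| ≤ 1) (θ : ℝ) {t : ℝ}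
    (ht : 0 ≤ t) (hAt : ∀ᵐ ω ∂P, Tendsto (fun s ↦ A s ω) (𝓝[>] t) (𝓝 (A t ω))) :
    Tendsto (fun s ↦ ∫ ω, A s ω * ((s - t)⁻¹ * (Real.exp (θ * pathPos (fun x ↦ N x ω) s)
        - Real.exp (θ * pathPos (fun x ↦ N x ω) t))) ∂P) (𝓝[>] t)
      (𝓝 (∫ ω, A t ω * (Real.exp (θ * pathPos (fun x ↦ N x ω) t)
        * (θ * pathSign (fun x ↦ N x ω) t)) ∂P)) := by
  have hev : ∀ᶠ s in 𝓝[>] t, s ∈ Ioo t (t + 1) := Ioo_mem_nhdsGT (by linarith)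
  refine tendsto_integral_filter_of_dominated_convergence
    (fun _ ↦ |θ| * Real.exp (|θ| * (t + 1))) ?_ ?_ (integrable_const _) ?_
  · filter_upwards [hev] with s hs
    exact (hA s).aestronglyMeasurable.mul
      (((hN.aestronglyMeasurable_exp θ (ht.trans hs.1.le)).sub
        (hN.aestronglyMeasurable_exp θ ht)).const_mul _)
  · filter_upwards [hev] with s hs
    filter_upwards [hN.monotone_path] with ω hω
    have hst : 0 < s - t := sub_pos.2 hs.1
    have h0 : |pathPos (fun x ↦ N x ω) s| ≤ t + 1 :=
      (abs_pathPos_le _ _).trans (by rw [abs_of_nonneg (ht.trans hs.1.le)]; exact hs.2.le)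
    have h0' : |pathPos (fun x ↦ N x ω) t| ≤ t + 1 :=
      (abs_pathPos_le _ _).trans (by rw [abs_of_nonneg ht]; linarith)
    have h1 := abs_exp_sub_exp_le (θ := θ) h0 h0'
    have h2 := abs_pathPos_sub_le hω t s
    rw [abs_of_pos hst] at h2
    rw [norm_mul, norm_mul, Real.norm_eq_abs, Real.norm_eq_abs, Real.norm_eq_abs, abs_inv,
      abs_of_pos hst]
    calc |A s ω| * ((s - t)⁻¹ * _)
        ≤ 1 * ((s - t)⁻¹ * (|θ| * Real.exp (|θ| * (t + 1)) * (s - t))) := by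
          refine mul_le_mul (hA1 s ω) ?_ (by positivity) zero_le_one
          refine mul_le_mul_of_nonneg_left (h1.trans ?_) (by positivity)
          exact mul_le_mul_of_nonneg_left h2 (by positivity)
      _ = |θ| * Real.exp (|θ| * (t + 1)) := by field_simp
  · filter_upwards [hN.monotone_path, hN.rightContinuous_path, hAt] with ω hω hωr hωA
    refine hωA.mul ?_
    have hd := ((hasDerivWithinAt_pathPos hω hωr t).const_mul θ).exp
    rw [← hasDerivWithinAt_Ioi_iff_Ici,
      hasDerivWithinAt_iff_tendsto_slope' (by simp)] at hd
    simpa [slope_fun_def] using hd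

lemma abs_integral_mul_sub_le [IsProbabilityMeasure P] (hN : IsPoissonProcess P lam N)
    {A : Ω → ℝ} (hA1 : ∀ ω, |A ω| ≤ 1) (θ : ℝ) {s t T : ℝ}
    (hs : s ∈ Icc 0 T) (ht : t ∈ Icc 0 T) :
    |∫ ω, A ω * (Real.exp (θ * pathPos (fun x ↦ N x ω) s)
      - Real.exp (θ * pathPos (fun x ↦ N x ω) t)) ∂P|
      ≤ |θ| * Real.exp (|θ| * T) * |s - t| := by
  have := norm_integral_le_of_norm_le_const (μ := P) (f := fun ω ↦
    A ω * (Real.exp (θ * pathPos (fun x ↦ N x ω) s)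
      - Real.exp (θ * pathPos (fun x ↦ N x ω) t)))
    (C := |θ| * Real.exp (|θ| * T) * |s - t|) (by
      filter_upwards [hN.monotone_path] with ω hω
      have h0 : |pathPos (fun x ↦ N x ω) s| ≤ T :=
        (abs_pathPos_le _ _).trans (by rw [abs_of_nonneg hs.1]; exact hs.2)
      have h0' : |pathPos (fun x ↦ N x ω) t| ≤ T :=
        (abs_pathPos_le _ _).trans (by rw [abs_of_nonneg ht.1]; exact ht.2)
      have h1 := abs_exp_sub_exp_le (θ := θ) h0 h0'
      have h2 := abs_pathPos_sub_le hω t s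
      rw [norm_mul, Real.norm_eq_abs, Real.norm_eq_abs, ← one_mul (|θ| * _ * _)]
      refine mul_le_mul (hA1 ω) (h1.trans ?_) (abs_nonneg _) zero_le_one
      exact mul_le_mul_of_nonneg_left h2 (by positivity))
  simpa using this

lemma posMgf_sub [IsProbabilityMeasure P] (hN : IsPoissonProcess P lam N) (θ : ℝ) {s t : ℝ}
    (hs : 0 ≤ s) (ht : 0 ≤ t) :
    posMgf P N θ s - posMgf P N θ t
      = ∫ ω, 1 * (Real.exp (θ * pathPos (fun x ↦ N x ω) s)
        - Real.exp (θ * pathPos (fun x ↦ N x ω) t)) ∂P := by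
  have h (s : ℝ) (hs : 0 ≤ s) := hN.integrable_mul_exp (A := fun _ ↦ 1) measurable_const
    (by simp) θ hs
  simp only [one_mul] at h ⊢
  exact (integral_sub (h s hs) (h t ht)).symm

/-- Product rule in discrete form: the change of the exponential is weighted by the later sign, and
the change of the sign is evaluated by `integral_later_sign_mul`, which is the source of the damping
-2λ. -/
lemma signedMgf_sub [IsProbabilityMeasure P] (hN : IsPoissonProcess P lam N) (θ : ℝ) {s t : ℝ}
    (ht : 0 ≤ t) (hts : t ≤ s) :
    signedMgf P N θ s - signedMgf P N θ t
      = ∫ ω, pathSign (fun x ↦ N x ω) s * (Real.exp (θ * pathPos (fun x ↦ N x ω) s)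
        - Real.exp (θ * pathPos (fun x ↦ N x ω) t)) ∂P
        + (Real.exp (-(2 * lam * (s - t))) - 1) * signedMgf P N θ t := by
  have hm := hN.measurable_pathSign s
  have h1 (ω : Ω) : |pathSign (fun x ↦ N x ω) s| ≤ 1 := (abs_pathSign _ _).le
  have h2 := hN.integral_later_sign_mul (s := t.toNNReal) (u := s.toNNReal)
    (Real.toNNReal_mono hts) θ
  rw [Real.coe_toNNReal _ ht, Real.coe_toNNReal _ (ht.trans hts)] at h2
  simp_rw [mul_sub]
  rw [integral_sub (hN.integrable_mul_exp hm h1 θ (ht.trans hts)) (hN.integrable_mul_exp hm h1 θ ht)]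
  have h3 : ∫ ω, pathSign (fun x ↦ N x ω) s * Real.exp (θ * pathPos (fun x ↦ N x ω) t) ∂P
    = Real.exp (-(2 * lam * (s - t))) * signedMgf P N θ t := h2
  rw [h3]
  simp only [signedMgf]
  ring_nf

lemma hasDerivWithinAt_posMgf [IsProbabilityMeasure P] (hN : IsPoissonProcess P lam N) (θ : ℝ)
    {t : ℝ} (ht : 0 ≤ t) :
    HasDerivWithinAt (posMgf P N θ) (θ * signedMgf P N θ t) (Ici t) t := by
  rw [← hasDerivWithinAt_Ioi_iff_Ici, hasDerivWithinAt_iff_tendsto_slope' (by simp)]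
  have h := hN.tendsto_integral_slope (A := fun _ _ ↦ 1) (fun _ ↦ measurable_const) (by simp) θ ht
    (.of_forall fun _ ↦ tendsto_const_nhds)
  have e : ∫ ω, 1 * (Real.exp (θ * pathPos (fun x ↦ N x ω) t)
      * (θ * pathSign (fun x ↦ N x ω) t)) ∂P = θ * signedMgf P N θ t := by
    rw [signedMgf, ← integral_const_mul]
    exact integral_congr_ae (.of_forall fun ω ↦ by ring)
  rw [e] at h
  refine h.congr' ?_
  filter_upwards [self_mem_nhdsWithin] with s hs
  rw [slope_def_field, hN.posMgf_sub θ (ht.trans (le_of_lt hs)) ht, div_eq_inv_mul,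
    ← integral_const_mul]
  exact integral_congr_ae (.of_forall fun ω ↦ by ring)

lemma hasDerivWithinAt_signedMgf [IsProbabilityMeasure P] (hN : IsPoissonProcess P lam N) (θ : ℝ)
    {t : ℝ} (ht : 0 ≤ t) :
    HasDerivWithinAt (signedMgf P N θ) (θ * posMgf P N θ t - 2 * lam * signedMgf P N θ t)
      (Ici t) t := by
  rw [← hasDerivWithinAt_Ioi_iff_Ici, hasDerivWithinAt_iff_tendsto_slope' (by simp)]
  have h := hN.tendsto_integral_slope (A := fun s ω ↦ pathSign (fun x ↦ N x ω) s)
    hN.measurable_pathSign (fun s ω ↦ (abs_pathSign _ _).le) θ ht (by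
      filter_upwards [hN.rightContinuous_path] with ω hω
      exact (continuousWithinAt_pathSign hω t).mono Ioi_subset_Ici_self)
  have e : ∫ ω, pathSign (fun x ↦ N x ω) t * (Real.exp (θ * pathPos (fun x ↦ N x ω) t)
      * (θ * pathSign (fun x ↦ N x ω) t)) ∂P = θ * posMgf P N θ t := by
    rw [posMgf, ← integral_const_mul]
    refine integral_congr_ae (.of_forall fun ω ↦ ?_)
    linear_combination θ * Real.exp (θ * pathPos (fun x ↦ N x ω) t)
      * pathSign_mul_self (fun x ↦ N x ω) t
  rw [e] at h
  have h2 : Tendsto (fun s ↦ (s - t)⁻¹ * (Real.exp (-(2 * lam * (s - t))) - 1)) (𝓝[>] t)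
      (𝓝 (-(2 * lam))) := by
    have hd : HasDerivAt (fun s : ℝ ↦ Real.exp (-(2 * lam * (s - t)))) (-(2 * lam)) t := by
      simpa using (((hasDerivAt_id t).sub_const t).const_mul (2 * (lam : ℝ))).neg.exp
    have := (hasDerivWithinAt_iff_tendsto_slope' (by simp)).1 (hd.hasDerivWithinAt (s := Ioi t))
    simpa [slope_fun_def] using this
  rw [show θ * posMgf P N θ t - 2 * lam * signedMgf P N θ t
    = θ * posMgf P N θ t + -(2 * lam) * signedMgf P N θ t by ring]
  refine (h.add (h2.mul_const (signedMgf P N θ t))).congr' ?_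
  filter_upwards [self_mem_nhdsWithin] with s hs
  rw [slope_def_field, hN.signedMgf_sub θ ht (le_of_lt hs), div_eq_inv_mul, mul_add,
    ← integral_const_mul]
  congr 1
  · exact integral_congr_ae (.of_forall fun ω ↦ by ring)
  · ring

lemma continuousOn_posMgf [IsProbabilityMeasure P] (hN : IsPoissonProcess P lam N) (θ T : ℝ) :
    ContinuousOn (posMgf P N θ) (Icc 0 T) := by
  refine (LipschitzOnWith.of_dist_le_mul (K := (|θ| * Real.exp (|θ| * T)).toNNReal)
    fun s hs t ht ↦ ?_).continuousOn
  rw [Real.dist_eq, Real.dist_eq, hN.posMgf_sub θ hs.1 ht.1, Real.coe_toNNReal _ (by positivity)]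
  exact hN.abs_integral_mul_sub_le (A := fun _ ↦ 1) (by simp) θ hs ht

lemma continuousOn_signedMgf [IsProbabilityMeasure P] (hN : IsPoissonProcess P lam N) (θ T : ℝ) :
    ContinuousOn (signedMgf P N θ) (Icc 0 T) := by
  set C : ℝ := |θ| * Real.exp (|θ| * T) + 2 * lam * Real.exp (|θ| * T) with hC
  -- Only t ≤ s is treated, since `signedMgf_sub` conditions on the earlier time; symmetry gives the
  -- rest.
  have key : ∀ s ∈ Icc 0 T, ∀ t ∈ Icc 0 T, t ≤ s →
      |signedMgf P N θ s - signedMgf P N θ t| ≤ C * |s - t| := by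
    intro s hs t ht hts
    rw [hN.signedMgf_sub θ ht.1 hts, hC, add_mul]
    refine (abs_add_le _ _).trans (add_le_add
      (hN.abs_integral_mul_sub_le (fun ω ↦ (abs_pathSign _ _).le) θ hs ht) ?_)
    have hst : 0 ≤ s - t := sub_nonneg.2 hts
    have h1 : |signedMgf P N θ t| ≤ Real.exp (|θ| * T) := by
      have := norm_integral_le_of_norm_le_const (μ := P) (f := fun ω ↦
        pathSign (fun x ↦ N x ω) t * Real.exp (θ * pathPos (fun x ↦ N x ω) t))
        (C := Real.exp (|θ| * T)) (.of_forall fun ω ↦ by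
          rw [norm_mul, Real.norm_eq_abs, Real.norm_eq_abs, abs_pathSign, Real.abs_exp, one_mul]
          refine exp_mul_le_of_abs_le ((abs_pathPos_le _ _).trans ?_)
          rw [abs_of_nonneg ht.1]; exact ht.2)
      simpa [signedMgf] using this
    have h2 : |Real.exp (-(2 * lam * (s - t))) - 1| ≤ 2 * lam * |s - t| := by
      have h3 := Real.add_one_le_exp (-(2 * (lam : ℝ) * (s - t)))
      have h4 : Real.exp (-(2 * lam * (s - t))) ≤ 1 :=
        Real.exp_le_one_iff.2 (by have := lam.2; simp only [neg_nonpos]; positivity)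
      rw [abs_of_nonpos (by linarith), abs_of_nonneg hst]
      linarith
    rw [abs_mul]
    calc _ ≤ (2 * lam * |s - t|) * Real.exp (|θ| * T) :=
          mul_le_mul h2 h1 (abs_nonneg _) (by positivity)
      _ = _ := by ring
  refine (LipschitzOnWith.of_dist_le_mul (K := C.toNNReal) fun s hs t ht ↦ ?_).continuousOn
  rw [Real.dist_eq, Real.dist_eq, Real.coe_toNNReal _ (by positivity)]
  rcases le_total t s with h | h
  · exact key s hs t ht h
  · rw [abs_sub_comm, abs_sub_comm s]
    exact key t ht s hs h

/-- The system has eigenvalues -λ ± √(λ² + θ²), and its initial value is (1, 1) because almost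
surely N_0 = 0. -/
lemma posMgf_eq [IsProbabilityMeasure P] (hN : IsPoissonProcess P lam N) (hlam : 0 < lam) (θ : ℝ)
    {t : ℝ} (ht : 0 ≤ t) :
    posMgf P N θ t = Real.exp (-(lam * t)) * (Real.cosh (√(lam ^ 2 + θ ^ 2) * t)
      + (lam + θ) / √(lam ^ 2 + θ ^ 2) * Real.sinh (√(lam ^ 2 + θ ^ 2) * t)) := by
  have hl : (0 : ℝ) < lam := hlam
  set μ := √((lam : ℝ) ^ 2 + θ ^ 2) with hμ
  have hμ0 : 0 < μ := Real.sqrt_pos.2 (by positivity)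
  have hμ2 : μ ^ 2 = lam ^ 2 + θ ^ 2 := Real.sq_sqrt (by positivity)
  let v : ℝ × ℝ →L[ℝ] ℝ × ℝ := (θ • ContinuousLinearMap.snd ℝ ℝ ℝ).prod
    (θ • ContinuousLinearMap.fst ℝ ℝ ℝ - (2 * (lam : ℝ)) • ContinuousLinearMap.snd ℝ ℝ ℝ)
  have hexp (s : ℝ) : HasDerivAt (fun s ↦ Real.exp (-(lam * s)))
      (Real.exp (-(lam * s)) * -lam) s := by
    simpa using ((hasDerivAt_id s).const_mul (lam : ℝ)).neg.exp
  have hcosh (s : ℝ) : HasDerivAt (fun s ↦ Real.cosh (μ * s)) (Real.sinh (μ * s) * μ) s := by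
    simpa using ((hasDerivAt_id s).const_mul μ).cosh
  have hsinh (s : ℝ) : HasDerivAt (fun s ↦ Real.sinh (μ * s)) (Real.cosh (μ * s) * μ) s := by
    simpa using ((hasDerivAt_id s).const_mul μ).sinh
  let g : ℝ → ℝ × ℝ := fun s ↦
    (Real.exp (-(lam * s)) * (Real.cosh (μ * s) + (lam + θ) / μ * Real.sinh (μ * s)),
      Real.exp (-(lam * s)) * (Real.cosh (μ * s) + (θ - lam) / μ * Real.sinh (μ * s)))
  have hg (s : ℝ) : HasDerivAt g (v (g s)) s := by
    have h1 := (hexp s).mul ((hcosh s).add ((hsinh s).const_mul ((lam + θ) / μ)))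
    have h2 := (hexp s).mul ((hcosh s).add ((hsinh s).const_mul ((θ - lam) / μ)))
    have h3 := h1.prodMk h2
    convert! h3 using 1
    have hs : Real.sinh (μ * s) * μ = Real.sinh (μ * s) * (lam ^ 2 + θ ^ 2) / μ := by
      rw [← hμ2]; field_simp
    ext
    · simp [v, g]
      rw [hs]
      field_simp
      ring
    · simp [v, g]
      rw [hs]
      field_simp
      ring
  let f : ℝ → ℝ × ℝ := fun s ↦ (posMgf P N θ s, signedMgf P N θ s)
  have h0 : f 0 = g 0 := by
    have hz (ω : Ω) : pathPos (fun x ↦ N x ω) 0 = 0 := by simp [pathPos]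
    have hs : ∫ ω, pathSign (fun x ↦ N x ω) 0 ∂P = 1 := by
      rw [integral_congr_ae (g := fun _ ↦ 1) ?_]
      · simp
      · filter_upwards [hN.start_zero] with ω hω
        simp [pathSign, hω]
    simp [f, g, posMgf, signedMgf, hz, hs]
  -- Right-continuous paths give only right derivatives; together with continuity these suffice for
  -- uniqueness.
  have := ODE_solution_unique_of_mem_Icc_right (v := fun _ ↦ v) (s := fun _ ↦ univ) (a := 0)
    (b := t) (fun _ _ ↦ v.lipschitz.lipschitzOnWith)
    (f := f) (g := g) ((hN.continuousOn_posMgf θ t).prodMk (hN.continuousOn_signedMgf θ t))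
    (fun s hs ↦ by
      have := (hN.hasDerivWithinAt_posMgf θ hs.1).prodMk (hN.hasDerivWithinAt_signedMgf θ hs.1)
      simpa [f, v] using this)
    (fun _ _ ↦ mem_univ _) (fun s _ ↦ (hg s).continuousAt.continuousWithinAt)
    (fun s _ ↦ (hg s).hasDerivWithinAt) (fun _ _ ↦ mem_univ _) h0
  exact congrArg Prod.fst (this ⟨ht, le_rfl⟩)

end IsPoissonProcess

end Transform

/-! ### Averaging over the initial direction -/

section MgfOfProcess

variable {Ω : Type*} [MeasurableSpace Ω] {P : Measure Ω} {lam : ℝ≥0}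

/-- Independence of D and N refers to the product σ-algebra on paths, so it is applied to the
Riemann sums, which are measurable for it, and then passed to the limit. -/
lemma IsPoissonProcess.integral_indicator_mul_exp [IsProbabilityMeasure P] {N : ℝ≥0 → Ω → ℕ} {D : Ω → ℝ}
    (hN : IsPoissonProcess P lam N) (hD : Measurable D) (hDN : IndepFun D (fun ω s ↦ N s ω) P)
    {d : ℝ} (hd : P {ω | D ω = d} = 1 / 2) (θ : ℝ) (t : ℝ≥0) :
    ∫ ω, ({d} : Set ℝ).indicator 1 (D ω) * Real.exp (θ * pathPos (fun x ↦ N x ω) t) ∂P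
      = 1 / 2 * posMgf P N θ t := by
  have hind : Measurable (({d} : Set ℝ).indicator (1 : ℝ → ℝ)) :=
    measurable_one.indicator (measurableSet_singleton d)
  have hind1 (x : ℝ) : |({d} : Set ℝ).indicator (1 : ℝ → ℝ) x| ≤ 1 := by
    by_cases hx : x = d <;> simp [indicator, hx]
  have hR (m : ℕ) : Measurable fun n : ℝ≥0 → ℕ ↦ Real.exp (θ * riemannSum n t m) :=
    ((measurable_riemannSum (N := fun (s : ℝ≥0) (n : ℝ≥0 → ℕ) ↦ n s) (fun s ↦ measurable_pi_apply s) t m).const_mul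
      θ).exp
  have hRN (m : ℕ) : Measurable fun ω ↦ Real.exp (θ * riemannSum (fun x ↦ N x ω) t m) :=
    ((measurable_riemannSum hN.measurable t m).const_mul θ).exp
  have hhalf : ∫ ω, ({d} : Set ℝ).indicator (1 : ℝ → ℝ) (D ω) ∂P = 1 / 2 := by
    have : (fun ω ↦ ({d} : Set ℝ).indicator (1 : ℝ → ℝ) (D ω))
        = (D ⁻¹' {d}).indicator 1 := by
      ext ω; simp [indicator]
    rw [this, integral_indicator_one (hD (measurableSet_singleton d)), measureReal_def,
      show P (D ⁻¹' {d}) = 1 / 2 from hd]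
    simp
  have key (A : Ω → ℝ) (hA : Measurable A) (hA1 : ∀ ω, |A ω| ≤ 1) : Tendsto
      (fun m ↦ ∫ ω, A ω * Real.exp (θ * riemannSum (fun x ↦ N x ω) t m) ∂P) atTop
      (𝓝 (∫ ω, A ω * Real.exp (θ * pathPos (fun x ↦ N x ω) t) ∂P)) := by
    refine tendsto_integral_of_dominated_convergence (fun _ ↦ 1 * Real.exp (|θ| * t)) (fun m ↦ ?_)
      (integrable_const _) (fun m ↦ .of_forall fun ω ↦ ?_) ?_
    · exact (hA.mul (hRN m)).aestronglyMeasurable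
    · rw [norm_mul, Real.norm_eq_abs, Real.norm_eq_abs, Real.abs_exp]
      exact mul_le_mul (hA1 ω) (exp_mul_le_of_abs_le (abs_riemannSum_le (fun x ↦ N x ω) t m))
        (Real.exp_pos _).le zero_le_one
    · filter_upwards [hN.tendsto_riemannSum t] with ω hω
      exact ((Real.continuous_exp.tendsto _).comp (hω.const_mul θ)).const_mul _
  have h1 := key _ (hind.comp hD) (fun ω ↦ hind1 _)
  have h2 := (key (fun _ ↦ 1) measurable_const (by simp)).const_mul (1 / 2)
  simp only [one_mul, Function.comp_def] at h1 h2
  refine tendsto_nhds_unique h1 (h2.congr fun m ↦ ?_)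
  have h3 := (hDN.comp hind (hR m)).integral_fun_mul_eq_mul_integral
    (hind.comp hD).aestronglyMeasurable (hRN m).aestronglyMeasurable
  simp only [Function.comp_def] at h3
  rw [h3, hhalf]

namespace IsTelegraphProcess

variable {c : ℝ} {X : ℝ≥0 → Ω → ℝ}

lemma ae_eq_or [IsProbabilityMeasure P] {D : Ω → ℝ} (hD : Measurable D) (h1 : P {ω | D ω = 1} = 1 / 2)
    (h2 : P {ω | D ω = -1} = 1 / 2) : ∀ᵐ ω ∂P, D ω = 1 ∨ D ω = -1 := by
  have hdisj : Disjoint {ω | D ω = 1} {ω | D ω = -1} := by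
    rw [Set.disjoint_left]
    intro ω hω hω'
    simp only [mem_ofPred_eq] at hω hω'
    rw [hω] at hω'
    norm_num at hω'
  have hu := measure_union (μ := P) hdisj (hD (measurableSet_singleton (-1)))
  rw [h1, h2, ENNReal.add_halves] at hu
  exact (prob_compl_eq_zero_iff ((hD (measurableSet_singleton 1)).union
    (hD (measurableSet_singleton (-1))))).2 hu

lemma exists_ae_eq (hX : IsTelegraphProcess P c lam X) (t : ℝ≥0) :
    ∃ (D : Ω → ℝ) (N : ℝ≥0 → Ω → ℕ), Measurable D ∧ P {ω | D ω = 1} = 1 / 2 ∧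
      P {ω | D ω = -1} = 1 / 2 ∧ IsPoissonProcess P lam N ∧ IndepFun D (fun ω s ↦ N s ω) P ∧
      ∀ᵐ ω ∂P, X t ω = c * D ω * pathPos (fun s ↦ N s ω) t := by
  obtain ⟨D, N, hD, h1, h2, hN, hDN, h⟩ := hX
  refine ⟨D, N, hD, h1, h2, hN, hDN, ?_⟩
  filter_upwards [h] with ω hω
  rw [hω t, pathPos, ← intervalIntegral.integral_const_mul]
  rfl

lemma aemeasurable [IsProbabilityMeasure P] (hX : IsTelegraphProcess P c lam X) (t : ℝ≥0) : AEMeasurable (X t) P := by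
  obtain ⟨D, N, hD, h1, h2, hN, hDN, h⟩ := hX.exists_ae_eq t
  refine AEMeasurable.congr ?_ (h.mono fun ω hω ↦ hω.symm)
  exact (hD.const_mul c).aemeasurable.mul (hN.aemeasurable_pathPos t.coe_nonneg)

lemma ae_abs_le [IsProbabilityMeasure P] (hX : IsTelegraphProcess P c lam X) (hc : 0 < c) (t : ℝ≥0) :
    ∀ᵐ ω ∂P, |X t ω| ≤ c * t := by
  obtain ⟨D, N, hD, h1, h2, hN, hDN, h⟩ := hX.exists_ae_eq t
  filter_upwards [h, ae_eq_or hD h1 h2] with ω hω hDω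
  have h3 : |D ω| = 1 := by rcases hDω with h | h <;> simp [h]
  have h4 := abs_pathPos_le (fun s ↦ N s ω) t
  rw [NNReal.abs_eq] at h4
  rw [hω, abs_mul, abs_mul, h3, abs_of_pos hc, mul_one]
  gcongr

/-- The two directions contribute the unit-speed transform at θc and at -θc; the part of λ ± θc odd
in θ cancels. -/
lemma mgf_eq [IsProbabilityMeasure P] (hX : IsTelegraphProcess P c lam X) (hlam : 0 < lam) (t : ℝ≥0) (θ : ℝ) :
    mgf (X t) P θ = Real.exp (-(lam * t)) * (Real.cosh (√(lam ^ 2 + (θ * c) ^ 2) * t)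
      + lam / √(lam ^ 2 + (θ * c) ^ 2) * Real.sinh (√(lam ^ 2 + (θ * c) ^ 2) * t)) := by
  obtain ⟨D, N, hD, h1, h2, hN, hDN, h⟩ := hX.exists_ae_eq t
  have hint (d ϑ : ℝ) : Integrable (fun ω ↦ ({d} : Set ℝ).indicator 1 (D ω)
      * Real.exp (ϑ * pathPos (fun x ↦ N x ω) t)) P := by
    refine hN.integrable_mul_exp
      ((measurable_one.indicator (measurableSet_singleton d)).comp hD) (fun ω ↦ ?_) ϑ t.coe_nonneg
    by_cases hx : D ω = d <;> simp [hx]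
  have e : mgf (X t) P θ = ∫ ω, (({1} : Set ℝ).indicator 1 (D ω)
        * Real.exp ((θ * c) * pathPos (fun x ↦ N x ω) t)
      + ({-1} : Set ℝ).indicator 1 (D ω)
        * Real.exp (-(θ * c) * pathPos (fun x ↦ N x ω) t)) ∂P := by
    refine integral_congr_ae ?_
    filter_upwards [h, ae_eq_or hD h1 h2] with ω hω hDω
    have hne : (1 : ℝ) ≠ -1 := by norm_num
    rcases hDω with h | h
    · simp [hω, h, hne, mul_assoc]
    · simp [hω, h, hne.symm, mul_assoc]
  rw [e, integral_add (hint _ _) (hint _ _), hN.integral_indicator_mul_exp hD hDN h1,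
    hN.integral_indicator_mul_exp hD hDN h2, hN.posMgf_eq hlam _ t.coe_nonneg, hN.posMgf_eq hlam _ t.coe_nonneg,
    neg_sq]
  ring

end IsTelegraphProcess

end MgfOfProcess

/-! ### F_k as a polynomial and as a primitive -/

section Hypergeometric

lemma eval_ascPochhammer_half_div (s : ℕ) :
    (ascPochhammer ℝ s).eval (1 / 2) * ((ascPochhammer ℝ s).eval (3 / 2))⁻¹ = 1 / (2 * s + 1) := by
  have hpos (s : ℕ) : (ascPochhammer ℝ s).eval (3 / 2) ≠ 0 :=
    (ascPochhammer_pos s (3 / 2 : ℝ) (by norm_num)).ne'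
  induction s with
  | zero => simp
  | succ s ih =>
    rw [← div_eq_mul_inv, div_eq_div_iff (hpos s) (by positivity)] at ih
    rw [← div_eq_mul_inv, div_eq_div_iff (hpos _) (by positivity), ascPochhammer_succ_eval,
      ascPochhammer_succ_eval]
    push_cast
    linear_combination (s + 3 / 2 : ℝ) * ih

lemma factorial_inv_mul_eval_ascPochhammer_neg (k s : ℕ) :
    ((s ! : ℝ))⁻¹ * (ascPochhammer ℝ s).eval (-(k : ℝ)) = (k.choose s : ℝ) * (-1) ^ s := by
  rw [ascPochhammer_eval_neg_eq_descPochhammer, descPochhammer_eval_eq_descFactorial,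
    Nat.descFactorial_eq_factorial_mul_choose]
  push_cast
  field_simp

/-- The series stops at s = k because (-k)_s / s! is (-1)^s times a binomial coefficient, and
(1/2)_s / (3/2)_s = 1/(2s + 1). -/
lemma hypF_eq_sum (k : ℕ) (z : ℝ) :
    hypF k z = ∑ s ∈ Finset.range (k + 1), (k.choose s : ℝ) * (-z) ^ s / (2 * s + 1) := by
  rw [hypF, ordinaryHypergeometric_eq_tsum]
  have h (s : ℕ) : (((s ! : ℝ))⁻¹ * (ascPochhammer ℝ s).eval (-(k : ℝ))
      * (ascPochhammer ℝ s).eval (1 / 2) * ((ascPochhammer ℝ s).eval (3 / 2))⁻¹) • z ^ s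
      = (k.choose s : ℝ) * (-z) ^ s / (2 * s + 1) := by
    rw [factorial_inv_mul_eval_ascPochhammer_neg, mul_assoc, eval_ascPochhammer_half_div,
      neg_pow z, smul_eq_mul]
    ring
  simp only [h]
  refine tsum_eq_sum fun s hs ↦ ?_
  rw [Finset.mem_range, not_lt] at hs
  simp [Nat.choose_eq_zero_of_lt (Nat.lt_of_succ_le hs)]

/-- The denominator 2s + 1 cancels on differentiating x^{2s+1}, leaving the binomial expansion. -/
lemma hasDerivAt_mul_hypF (k : ℕ) (q x : ℝ) :
    HasDerivAt (fun x ↦ x * hypF k (x ^ 2 / q)) ((1 - x ^ 2 / q) ^ k) x := by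
  have e : (fun x : ℝ ↦ x * hypF k (x ^ 2 / q)) = fun x ↦
      ∑ s ∈ Finset.range (k + 1), ((k.choose s : ℝ) * (-1 / q) ^ s / (2 * s + 1))
        * x ^ (2 * s + 1) := by
    ext x
    rw [hypF_eq_sum, Finset.mul_sum]
    refine Finset.sum_congr rfl fun s _ ↦ ?_
    rw [show -(x ^ 2 / q) = (-1 / q) * x ^ 2 by ring, mul_pow]
    ring
  rw [e]
  have h := HasDerivAt.fun_sum (u := Finset.range (k + 1)) (x := x) fun s _ ↦
    (hasDerivAt_pow (2 * s + 1) x).const_mul ((k.choose s : ℝ) * (-1 / q) ^ s / (2 * s + 1))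
  convert! h using 1
  rw [sub_eq_neg_add, add_pow]
  refine Finset.sum_congr rfl fun s _ ↦ ?_
  rw [show -(x ^ 2 / q) = (-1 / q) * x ^ 2 by ring, mul_pow]
  have : (2 * (s : ℝ) + 1) ≠ 0 := by positivity
  simp only [Nat.add_sub_cancel]
  push_cast
  field_simp
  ring

lemma integral_one_sub_pow (k : ℕ) (q a b : ℝ) :
    ∫ x in a..b, (1 - x ^ 2 / q) ^ k = b * hypF k (b ^ 2 / q) - a * hypF k (a ^ 2 / q) :=
  intervalIntegral.integral_eq_sub_of_hasDerivAt (fun x _ ↦ hasDerivAt_mul_hypF k q x)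
    (Continuous.intervalIntegrable (by fun_prop) _ _)

lemma continuous_mul_hypF (k : ℕ) (q : ℝ) : Continuous fun x ↦ x * hypF k (x ^ 2 / q) :=
  continuous_iff_continuousAt.2 fun x ↦ (hasDerivAt_mul_hypF k q x).continuousAt

end Hypergeometric

/-! ### The density as a power series -/

section Bessel

lemma coeff_nonneg {L t : ℝ} (h : 0 ≤ L * t) (k : ℕ) : 0 ≤ coeff L t k := by
  unfold coeff
  rw [pow_mul]
  positivity

lemma summable_pow_div_factorial_sq (w : ℝ) : Summable fun k : ℕ ↦ w ^ k / (k ! : ℝ) ^ 2 := by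
  refine Summable.of_norm_bounded (Real.summable_pow_div_factorial |w|) fun k ↦ ?_
  have h1 : (1 : ℝ) ≤ k ! := by exact_mod_cast Nat.one_le_iff_ne_zero.2 k.factorial_ne_zero
  rw [Real.norm_eq_abs, abs_div, abs_pow, abs_of_nonneg (by positivity : (0 : ℝ) ≤ (k ! : ℝ) ^ 2)]
  gcongr
  nlinarith

lemma summable_pow_div_factorial_mul (w : ℝ) :
    Summable fun k : ℕ ↦ w ^ k / ((k ! : ℝ) * (k + 1)!) := by
  refine Summable.of_norm_bounded (Real.summable_pow_div_factorial |w|) fun k ↦ ?_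
  have h1 : (1 : ℝ) ≤ (k + 1)! := by
    exact_mod_cast Nat.one_le_iff_ne_zero.2 (k + 1).factorial_ne_zero
  have h2 : (0 : ℝ) < k ! := by positivity
  rw [Real.norm_eq_abs, abs_div, abs_pow,
    abs_of_nonneg (by positivity : (0 : ℝ) ≤ (k ! : ℝ) * (k + 1)!)]
  gcongr
  nlinarith

/-- The two summands are the contributions of I_0 and I_1. -/
lemma coeff_eq (L t : ℝ) (k : ℕ) :
    coeff L t k = ((L * t / 2) ^ 2) ^ k / (k ! : ℝ) ^ 2
      + L * t / 2 * (((L * t / 2) ^ 2) ^ k / ((k ! : ℝ) * (k + 1)!)) := by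
  rw [coeff, pow_mul, Nat.factorial_succ]
  push_cast
  field_simp

lemma summable_coeff (L t : ℝ) : Summable (coeff L t) := by
  simp_rw [funext (coeff_eq L t)]
  exact (summable_pow_div_factorial_sq _).add ((summable_pow_div_factorial_mul _).mul_left _)

/-- The common factor of the density in terms of `q = (c t) ^ 2`. -/
noncomputable def densitySeries (L t q x : ℝ) : ℝ := ∑' k, coeff L t k * (1 - x ^ 2 / q) ^ k

lemma one_sub_sq_div_mem {R x : ℝ} (hx : x ∈ Icc (-R) R) : 1 - x ^ 2 / R ^ 2 ∈ Icc (0 : ℝ) 1 := by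
  have h : x ^ 2 ≤ R ^ 2 := sq_le_sq' hx.1 hx.2
  have h1 : x ^ 2 / R ^ 2 ≤ 1 := div_le_one_of_le₀ h (sq_nonneg R)
  have h2 : 0 ≤ x ^ 2 / R ^ 2 := by positivity
  exact ⟨by linarith, by linarith⟩

lemma norm_coeff_mul_le {L t R x : ℝ} (h : 0 ≤ L * t) (hx : x ∈ Icc (-R) R) (k : ℕ) :
    ‖coeff L t k * (1 - x ^ 2 / R ^ 2) ^ k‖ ≤ coeff L t k := by
  have hm := one_sub_sq_div_mem hx
  rw [norm_mul, Real.norm_of_nonneg (coeff_nonneg h k), Real.norm_of_nonneg (pow_nonneg hm.1 k)]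
  exact mul_le_of_le_one_right (coeff_nonneg h k) (pow_le_one₀ hm.1 hm.2)

lemma hasSum_densitySeries {L t R x : ℝ} (h : 0 ≤ L * t) (hx : x ∈ Icc (-R) R) :
    HasSum (fun k ↦ coeff L t k * (1 - x ^ 2 / R ^ 2) ^ k) (densitySeries L t (R ^ 2) x) :=
  (Summable.of_norm_bounded (summable_coeff L t) (norm_coeff_mul_le h hx)).hasSum

lemma densitySeries_nonneg {L t R x : ℝ} (h : 0 ≤ L * t) (hx : x ∈ Icc (-R) R) :
    0 ≤ densitySeries L t (R ^ 2) x :=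
  tsum_nonneg fun k ↦ mul_nonneg (coeff_nonneg h k) (pow_nonneg (one_sub_sq_div_mem hx).1 k)

lemma continuousOn_densitySeries {L t : ℝ} (h : 0 ≤ L * t) (R : ℝ) :
    ContinuousOn (densitySeries L t (R ^ 2)) (Icc (-R) R) :=
  continuousOn_tsum (fun k ↦ Continuous.continuousOn (by fun_prop)) (summable_coeff L t)
    fun k _ hx ↦ norm_coeff_mul_le h hx k

/-- Both Bessel terms are power series in 1 - x²/(ct)². The interval must be open: at x = ±ct
division by zero kills the I_1 term, whereas the series keeps its limit Lt/2. -/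
lemma besselI_add_besselI_eq {c t L x : ℝ} (hc : 0 < c) (ht : 0 < t)
    (hx : x ∈ Ioo (-(c * t)) (c * t)) :
    besselI 0 (L / c * √(c ^ 2 * t ^ 2 - x ^ 2))
      + c * t / √(c ^ 2 * t ^ 2 - x ^ 2) * besselI 1 (L / c * √(c ^ 2 * t ^ 2 - x ^ 2))
      = densitySeries L t (c ^ 2 * t ^ 2) x := by
  have hR : 0 < c * t := mul_pos hc ht
  have hw0 : 0 < c ^ 2 * t ^ 2 - x ^ 2 := by
    have := sq_lt_sq' hx.1 hx.2
    nlinarith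
  set S := √(c ^ 2 * t ^ 2 - x ^ 2) with hS
  have hS0 : 0 < S := Real.sqrt_pos.2 hw0
  have hS2 : S ^ 2 = c ^ 2 * t ^ 2 - x ^ 2 := Real.sq_sqrt hw0.le
  have hz : (L / c * S / 2) ^ 2 = (L * t / 2) ^ 2 * (1 - x ^ 2 / (c ^ 2 * t ^ 2)) := by
    rw [mul_div_assoc, mul_pow, div_pow S, hS2]
    field_simp
  have h0 : besselI 0 (L / c * S) = ∑' k : ℕ, ((L / c * S / 2) ^ 2) ^ k / (k ! : ℝ) ^ 2 := by
    refine tsum_congr fun k ↦ ?_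
    simp only [add_zero, pow_mul]
    field_simp
  have h1 : c * t / S * besselI 1 (L / c * S)
      = ∑' k : ℕ, L * t / 2 * (((L / c * S / 2) ^ 2) ^ k / ((k ! : ℝ) * (k + 1)!)) := by
    rw [besselI, ← tsum_mul_left]
    refine tsum_congr fun k ↦ ?_
    rw [pow_succ, pow_mul]
    field_simp
  rw [h0, h1, ← (summable_pow_div_factorial_sq _).tsum_add
    ((summable_pow_div_factorial_mul _).mul_left _), densitySeries]
  refine tsum_congr fun k ↦ ?_
  rw [coeff_eq, hz, mul_pow]
  ring

end Bessel

/-! ### Laplace transform of the density -/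

section DensityTransform

/-- The integral of `x ^ (2 j) * (1 - x ^ 2) ^ k` over `[-1, 1]`. -/
noncomputable def betaMoment (k j : ℕ) : ℝ :=
  ((2 * j)! : ℝ) * 4 ^ (k + 1) * k ! * (j + k + 1)! / (j ! * (2 * (j + k + 1))!)

lemma betaMoment_zero (j : ℕ) : betaMoment 0 j = 2 / (2 * j + 1) := by
  have h : (2 * (j + 0 + 1))! = (2 * j + 2) * ((2 * j + 1) * (2 * j)!) := by
    rw [show 2 * (j + 0 + 1) = 2 * j + 1 + 1 by ring, Nat.factorial_succ, Nat.factorial_succ]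
  rw [betaMoment, h, show j + 0 + 1 = j + 1 by ring, Nat.factorial_succ]
  push_cast
  have h1 : (2 * (j : ℝ) + 1) ≠ 0 := by positivity
  have h2 : (j : ℝ) + 1 ≠ 0 := by positivity
  field_simp
  norm_num

lemma betaMoment_succ (k j : ℕ) :
    betaMoment (k + 1) j = betaMoment k j - betaMoment k (j + 1) := by
  have h : (2 * (j + k + 1 + 1))!
      = (2 * (j + k + 1) + 2) * ((2 * (j + k + 1) + 1) * (2 * (j + k + 1))!) := by
    rw [show 2 * (j + k + 1 + 1) = 2 * (j + k + 1) + 1 + 1 by ring, Nat.factorial_succ,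
      Nat.factorial_succ]
  have h' : (2 * (j + 1))! = (2 * j + 2) * ((2 * j + 1) * (2 * j)!) := by
    rw [show 2 * (j + 1) = 2 * j + 1 + 1 by ring, Nat.factorial_succ, Nat.factorial_succ]
  rw [betaMoment, betaMoment, betaMoment, show j + (k + 1) + 1 = j + k + 1 + 1 by ring,
    show j + 1 + k + 1 = j + k + 1 + 1 by ring, h, h', Nat.factorial_succ (j + k + 1),
    Nat.factorial_succ k, Nat.factorial_succ j]
  have h1 : (2 * ((j : ℝ) + k + 1) + 1) ≠ 0 := by positivity
  have h2 : ((j : ℝ) + k + 1 + 1) ≠ 0 := by positivity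
  have h3 : (j : ℝ) + 1 ≠ 0 := by positivity
  push_cast
  rw [show 2 * ((j : ℝ) + k + 1) + 2 = 2 * (j + k + 1 + 1) by ring]
  field_simp
  ring

/-- Splitting off one factor 1 - x²/R² gives the recursion `betaMoment_succ` in k at the exponents j
and j + 1, so no integration by parts is needed. -/
lemma integral_pow_mul_one_sub_pow {R : ℝ} (hR : 0 < R) (k j : ℕ) :
    ∫ x in (-R)..R, x ^ (2 * j) * (1 - x ^ 2 / R ^ 2) ^ k = R ^ (2 * j + 1) * betaMoment k j := by
  induction k generalizing j with
  | zero =>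
    simp only [pow_zero, mul_one, integral_pow, betaMoment_zero]
    rw [Odd.neg_pow ⟨j, rfl⟩]
    push_cast
    ring
  | succ k ih =>
    have h (x : ℝ) : x ^ (2 * j) * (1 - x ^ 2 / R ^ 2) ^ (k + 1)
        = x ^ (2 * j) * (1 - x ^ 2 / R ^ 2) ^ k
          - (R ^ 2)⁻¹ * (x ^ (2 * (j + 1)) * (1 - x ^ 2 / R ^ 2) ^ k) := by
      ring
    simp_rw [h]
    rw [intervalIntegral.integral_sub (Continuous.intervalIntegrable (by fun_prop) _ _)
      (Continuous.intervalIntegrable (by fun_prop) _ _), intervalIntegral.integral_const_mul,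
      ih, ih, betaMoment_succ]
    field_simp
    ring

lemma hasSum_integral_cosh_mul_densitySeries {L t R : ℝ} (h : 0 ≤ L * t) (hR : 0 < R) (θ : ℝ) :
    HasSum (fun p : ℕ × ℕ ↦ coeff L t p.1 * (θ ^ (2 * p.2) / (2 * p.2)!)
        * (R ^ (2 * p.2 + 1) * betaMoment p.1 p.2))
      (∫ x in (-R)..R, densitySeries L t (R ^ 2) x * Real.cosh (θ * x)) := by
  have hle : -R ≤ R := by linarith
  have hbound : Summable fun p : ℕ × ℕ ↦ coeff L t p.1 * ((|θ| * R) ^ (2 * p.2) / (2 * p.2)!) :=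
    (summable_coeff L t).mul_of_nonneg (Real.hasSum_cosh (|θ| * R)).summable
      (fun k ↦ coeff_nonneg h k) fun j ↦ by positivity
  have hterm (p : ℕ × ℕ) (x : ℝ) (hx : x ∈ Icc (-R) R) :
      ‖(coeff L t p.1 * (1 - x ^ 2 / R ^ 2) ^ p.1) * ((θ * x) ^ (2 * p.2) / (2 * p.2)!)‖
        ≤ coeff L t p.1 * ((|θ| * R) ^ (2 * p.2) / (2 * p.2)!) := by
    rw [norm_mul]
    refine mul_le_mul (norm_coeff_mul_le h hx p.1) ?_ (norm_nonneg _) (coeff_nonneg h _)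
    rw [norm_div, norm_pow, norm_mul, Real.norm_eq_abs, Real.norm_eq_abs,
      Real.norm_of_nonneg (by positivity : (0 : ℝ) ≤ ((2 * p.2)! : ℝ))]
    gcongr
    exact abs_le.2 hx
  have key := intervalIntegral.hasSum_integral_of_dominated_convergence (μ := volume)
    (a := -R) (b := R)
    (F := fun (p : ℕ × ℕ) x ↦
      (coeff L t p.1 * (1 - x ^ 2 / R ^ 2) ^ p.1) * ((θ * x) ^ (2 * p.2) / (2 * p.2)!))
    (f := fun x ↦ densitySeries L t (R ^ 2) x * Real.cosh (θ * x))
    (fun p _ ↦ coeff L t p.1 * ((|θ| * R) ^ (2 * p.2) / (2 * p.2)!))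
    (fun p ↦ Continuous.aestronglyMeasurable (by fun_prop))
    (fun p ↦ .of_forall fun x hx ↦ hterm p x (Ioc_subset_Icc_self (uIoc_of_le hle ▸ hx)))
    (.of_forall fun _ _ ↦ hbound) intervalIntegrable_const
    (.of_forall fun x hx ↦ by
      have hx' : x ∈ Icc (-R) R := Ioc_subset_Icc_self (uIoc_of_le hle ▸ hx)
      exact (hasSum_densitySeries h hx').mul (Real.hasSum_cosh (θ * x))
        (Summable.of_norm_bounded hbound fun p ↦ hterm p x hx'))
  refine key.congr_fun fun p ↦ ?_
  rw [← integral_pow_mul_one_sub_pow hR, ← intervalIntegral.integral_const_mul]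
  refine intervalIntegral.integral_congr fun x _ ↦ ?_
  ring

/-- With n = k + j, the I_0 part becomes a binomial term of (A + B)^n, and the I_1 part one of (A +
B)^{n+1}, where A = (Lt)² and B = b². The latter always contains a factor A. -/
lemma coeff_mul_betaMoment_eq (L t b : ℝ) (k j : ℕ) :
    L * t / 2 * (coeff L t k * (b ^ (2 * j) / (2 * j)!) * betaMoment k j)
      = L * t / (2 * (k + j) + 1)! * (((k + j).choose k : ℝ) * (((L * t) ^ 2) ^ k * (b ^ 2) ^ j))
        + ((k + j + 1).choose (k + 1) : ℝ) * (((L * t) ^ 2) ^ (k + 1) * (b ^ 2) ^ j)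
          / (2 * (k + j) + 2)! := by
  have h1 : ((k + j).choose k : ℝ) = (k + j)! / (k ! * j !) := by
    rw [eq_div_iff (by positivity), Nat.add_comm k j, ← Nat.add_choose_mul_factorial_mul_factorial]
    push_cast
    ring
  have h2 : ((k + j + 1).choose (k + 1) : ℝ) = (k + j + 1)! / ((k + 1)! * j !) := by
    have := Nat.add_choose_mul_factorial_mul_factorial j (k + 1)
    rw [show j + (k + 1) = k + j + 1 by ring] at this
    rw [eq_div_iff (by positivity), ← this]
    push_cast
    ring
  have h3 : (2 * (j + k + 1))! = (2 * (k + j) + 2) * (2 * (k + j) + 1)! := by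
    rw [show 2 * (j + k + 1) = 2 * (k + j) + 1 + 1 by ring, Nat.factorial_succ]
  rw [h1, h2, coeff, betaMoment, h3, Nat.factorial_succ (2 * (k + j) + 1), Nat.factorial_succ k,
    show j + k + 1 = k + j + 1 by ring, Nat.factorial_succ (k + j)]
  have h4 : (2 * ((k : ℝ) + j) + 1 + 1) ≠ 0 := by positivity
  have h5 : (k : ℝ) + 1 ≠ 0 := by positivity
  have h6 : (k : ℝ) + j + 1 ≠ 0 := by positivity
  push_cast
  rw [show 2 * ((k : ℝ) + j) + 2 = 2 * (k + j + 1) by ring,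
    show 2 * ((k : ℝ) + j) + 1 + 1 = 2 * (k + j + 1) by ring,
    show 2 * (k : ℝ) + 2 = 2 * (k + 1) by ring,
    div_pow (L * t) 2 (2 * k),
    show (4 : ℝ) ^ (k + 1) = 2 ^ (2 * k) * 4 by rw [pow_mul, pow_succ]; norm_num]
  field_simp
  ring

/-- Over k + j = n the I_0 terms fill the binomial formula, while the I_1 terms miss exactly the
pure power of b². The missing powers sum to the cosh that the atoms of the law supply. -/
lemma sum_antidiagonal_coeff_mul_betaMoment (L t b : ℝ) (n : ℕ) :
    ∑ p ∈ Finset.HasAntidiagonal.antidiagonal n,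
        L * t / 2 * (coeff L t p.1 * (b ^ (2 * p.2) / (2 * p.2)!) * betaMoment p.1 p.2)
      = L * t / (2 * n + 1)! * ((L * t) ^ 2 + b ^ 2) ^ n
        + (((L * t) ^ 2 + b ^ 2) ^ (n + 1) - (b ^ 2) ^ (n + 1)) / (2 * n + 2)! := by
  have e1 := (Commute.all ((L * t) ^ 2) (b ^ 2)).add_pow' n
  have e2 := (Commute.all ((L * t) ^ 2) (b ^ 2)).add_pow' (n + 1)
  rw [Finset.Nat.sum_antidiagonal_succ] at e2
  simp only [nsmul_eq_mul, Nat.choose_zero_right, Nat.cast_one, one_mul, pow_zero] at e1 e2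
  rw [e2, add_sub_cancel_left, e1, Finset.mul_sum, Finset.sum_div, ← Finset.sum_add_distrib]
  refine Finset.sum_congr rfl fun p hp ↦ ?_
  obtain rfl := Finset.HasAntidiagonal.mem_antidiagonal.1 hp
  exact coeff_mul_betaMoment_eq L t b p.1 p.2

lemma integral_densitySeries_mul_cosh {c t L : ℝ} (hc : 0 < c) (ht : 0 < t) (hL : 0 < L) (θ : ℝ) :
    L / (2 * c) * ∫ x in (-(c * t))..(c * t),
        densitySeries L t ((c * t) ^ 2) x * Real.cosh (θ * x)
      = Real.cosh √((L * t) ^ 2 + (θ * (c * t)) ^ 2)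
        + L * t / √((L * t) ^ 2 + (θ * (c * t)) ^ 2)
          * Real.sinh √((L * t) ^ 2 + (θ * (c * t)) ^ 2)
        - Real.cosh (θ * (c * t)) := by
  have hR : 0 < c * t := mul_pos hc ht
  have hA : 0 < L * t := mul_pos hL ht
  set b := θ * (c * t) with hb
  set M := √((L * t) ^ 2 + b ^ 2) with hM
  have hM0 : 0 < M := Real.sqrt_pos.2 (by positivity)
  have hM2 : M ^ 2 = (L * t) ^ 2 + b ^ 2 := Real.sq_sqrt (by positivity)
  have h1 := (hasSum_integral_cosh_mul_densitySeries hA.le hR θ).mul_left (L / (2 * c))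
  -- Absolute convergence allows summation along the antidiagonals k + j = n.
  have h2 := (Finset.HasAntidiagonal.sigmaAntidiagonalEquivProd.hasSum_iff.2 h1).sigma fun n ↦ hasSum_fintype _
  have h3 (n : ℕ) : ∑ p : Finset.HasAntidiagonal.antidiagonal n, (((fun p : ℕ × ℕ ↦ L / (2 * c)
      * (coeff L t p.1 * (θ ^ (2 * p.2) / (2 * p.2)!)
        * ((c * t) ^ (2 * p.2 + 1) * betaMoment p.1 p.2))) ∘ Finset.HasAntidiagonal.sigmaAntidiagonalEquivProd)
          ⟨n, p⟩) = L * t / (2 * n + 1)! * (M ^ 2) ^ n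
        + ((M ^ 2) ^ (n + 1) - (b ^ 2) ^ (n + 1)) / (2 * n + 2)! := by
    rw [hM2, ← sum_antidiagonal_coeff_mul_betaMoment, ← Finset.sum_coe_sort (Finset.HasAntidiagonal.antidiagonal n)]
    refine Finset.sum_congr rfl fun p _ ↦ ?_
    simp only [Function.comp, Finset.HasAntidiagonal.sigmaAntidiagonalEquivProd_apply, hb]
    field_simp
    ring
  simp_rw [h3] at h2
  have h4 : HasSum (fun n : ℕ ↦ L * t / (2 * n + 1)! * (M ^ 2) ^ n)
      (L * t / M * Real.sinh M) := by
    refine ((Real.hasSum_sinh M).mul_left (L * t / M)).congr_fun fun n ↦ ?_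
    rw [pow_succ M (2 * n), pow_mul M 2 n]
    field_simp
  -- The cosh series without its constant term; the two constants cancel in cosh M - cosh b.
  have h5 (a : ℝ) : HasSum (fun n : ℕ ↦ (a ^ 2) ^ (n + 1) / (2 * n + 2)!) (Real.cosh a - 1) := by
    have := (hasSum_nat_add_iff' 1).2 (Real.hasSum_cosh a)
    simpa [← pow_mul, mul_add] using this
  have h6 := h4.add ((h5 M).sub (h5 b))
  refine (h2.unique (h6.congr_fun fun n ↦ by ring)).trans ?_
  ring

lemma intervalIntegrable_densitySeries_mul {L t R : ℝ} (h : 0 ≤ L * t) (hR : 0 ≤ R) {f : ℝ → ℝ}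
    (hf : ContinuousOn f (Icc (-R) R)) :
    IntervalIntegrable (fun x ↦ densitySeries L t (R ^ 2) x * f x) volume (-R) R := by
  refine ContinuousOn.intervalIntegrable ?_
  rw [uIcc_of_le (by linarith)]
  exact (continuousOn_densitySeries h R).mul hf

lemma integral_densitySeries_mul_exp {L t R : ℝ} (h : 0 ≤ L * t) (hR : 0 ≤ R) (θ : ℝ) :
    ∫ x in (-R)..R, densitySeries L t (R ^ 2) x * Real.exp (θ * x)
      = ∫ x in (-R)..R, densitySeries L t (R ^ 2) x * Real.cosh (θ * x) := by
  have h1 : ∫ x in (-R)..R, densitySeries L t (R ^ 2) x * Real.exp (θ * x)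
      = ∫ x in (-R)..R, densitySeries L t (R ^ 2) x * Real.exp (-(θ * x)) := by
    have := intervalIntegral.integral_comp_neg (a := -R) (b := R)
      fun x ↦ densitySeries L t (R ^ 2) x * Real.exp (-(θ * x))
    rw [neg_neg] at this
    rw [← this]
    simp [densitySeries]
  have h2 : ∀ x, densitySeries L t (R ^ 2) x * Real.cosh (θ * x)
      = 1 / 2 * (densitySeries L t (R ^ 2) x * Real.exp (θ * x)
        + densitySeries L t (R ^ 2) x * Real.exp (-(θ * x))) := fun x ↦ by
    rw [Real.cosh_eq]; ring
  simp_rw [h2]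
  rw [intervalIntegral.integral_const_mul, intervalIntegral.integral_add
    (intervalIntegrable_densitySeries_mul h hR (by fun_prop))
    (intervalIntegrable_densitySeries_mul h hR (by fun_prop)), ← h1]
  ring

end DensityTransform

/-! ### The explicit law and its identification -/

section Law

/-- The density of the absolutely continuous part of the law at time `t` of the telegraph process
of speed `c` and rate `L`. -/
noncomputable def density (c L t x : ℝ) : ℝ :=
  L * Real.exp (-(L * t)) / (2 * c) * densitySeries L t ((c * t) ^ 2) x

/-- The law at time `t` of the telegraph process of speed `c` and rate `L`. -/
noncomputable def law (c L t : ℝ) : Measure ℝ :=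
  ENNReal.ofReal (Real.exp (-(L * t)) / 2) • (Measure.dirac (c * t) + Measure.dirac (-(c * t)))
    + (volume.restrict (Ioc (-(c * t)) (c * t))).withDensity
      fun x ↦ ENNReal.ofReal (density c L t x)

variable {c L t : ℝ}

lemma continuousOn_density (hL : 0 < L) (ht : 0 < t) :
    ContinuousOn (density c L t) (Icc (-(c * t)) (c * t)) :=
  continuousOn_const.mul (continuousOn_densitySeries (by positivity) _)

lemma density_nonneg (hc : 0 < c) (hL : 0 < L) (ht : 0 < t) {x : ℝ}
    (hx : x ∈ Icc (-(c * t)) (c * t)) : 0 ≤ density c L t x :=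
  mul_nonneg (by positivity) (densitySeries_nonneg (by positivity) hx)

lemma density_neg (x : ℝ) : density c L t (-x) = density c L t x := by
  simp [density, densitySeries]

lemma aemeasurable_density (hL : 0 < L) (ht : 0 < t) :
    AEMeasurable (density c L t) (volume.restrict (Ioc (-(c * t)) (c * t))) :=
  ((continuousOn_density hL ht).mono Ioc_subset_Icc_self).aemeasurable measurableSet_Ioc

lemma ae_toReal_density (hc : 0 < c) (hL : 0 < L) (ht : 0 < t) (f : ℝ → ℝ) :
    (fun x ↦ (ENNReal.ofReal (density c L t x)).toReal • f x)
      =ᵐ[volume.restrict (Ioc (-(c * t)) (c * t))] fun x ↦ density c L t x * f x := by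
  filter_upwards [ae_restrict_mem measurableSet_Ioc] with x hx
  rw [ENNReal.toReal_ofReal (density_nonneg hc hL ht (Ioc_subset_Icc_self hx)), smul_eq_mul]

lemma integrable_withDensity_density (hc : 0 < c) (hL : 0 < L) (ht : 0 < t) {f : ℝ → ℝ}
    (hf : IntervalIntegrable (fun x ↦ density c L t x * f x) volume (-(c * t)) (c * t)) :
    Integrable f ((volume.restrict (Ioc (-(c * t)) (c * t))).withDensity
      fun x ↦ ENNReal.ofReal (density c L t x)) := by
  have hR : 0 < c * t := mul_pos hc ht
  rw [integrable_withDensity_iff_integrable_smul₀' (aemeasurable_density hL ht).ennreal_ofReal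
    (.of_forall fun _ ↦ ENNReal.ofReal_lt_top), integrable_congr (ae_toReal_density hc hL ht f)]
  exact (intervalIntegrable_iff_integrableOn_Ioc_of_le (by linarith)).1 hf

lemma integral_law (hc : 0 < c) (hL : 0 < L) (ht : 0 < t) {f : ℝ → ℝ}
    (hf : IntervalIntegrable (fun x ↦ density c L t x * f x) volume (-(c * t)) (c * t)) :
    ∫ x, f x ∂law c L t = Real.exp (-(L * t)) / 2 * (f (c * t) + f (-(c * t)))
      + ∫ x in (-(c * t))..(c * t), density c L t x * f x := by
  have hR : 0 < c * t := mul_pos hc ht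
  have hd (a : ℝ) : Integrable f (Measure.dirac a) := integrable_dirac (by simp)
  rw [law, integral_add_measure
    (((hd _).add_measure (hd _)).smul_measure ENNReal.ofReal_ne_top)
    (integrable_withDensity_density hc hL ht hf), integral_smul_measure,
    integral_add_measure (hd _) (hd _), integral_dirac, integral_dirac,
    ENNReal.toReal_ofReal (by positivity), smul_eq_mul,
    integral_withDensity_eq_integral_toReal_smul₀ (aemeasurable_density hL ht).ennreal_ofReal
    (.of_forall fun _ ↦ ENNReal.ofReal_lt_top), integral_congr_ae (ae_toReal_density hc hL ht f),
    intervalIntegral.integral_of_le (by linarith)]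

lemma isFiniteMeasure_law (hc : 0 < c) (hL : 0 < L) (ht : 0 < t) :
    IsFiniteMeasure (law c L t) := by
  have hR : 0 < c * t := mul_pos hc ht
  have h1 : IntervalIntegrable (fun x ↦ density c L t x * 1) volume (-(c * t)) (c * t) := by
    refine ContinuousOn.intervalIntegrable ?_
    rw [uIcc_of_le (by linarith)]
    exact (continuousOn_density hL ht).mul continuousOn_const
  have h2 := integrable_withDensity_density hc hL ht h1
  have h3 : IsFiniteMeasure ((volume.restrict (Ioc (-(c * t)) (c * t))).withDensity
      fun x ↦ ENNReal.ofReal (density c L t x)) :=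
    (integrable_const_iff_isFiniteMeasure one_ne_zero).1 h2
  have h4 : IsFiniteMeasure (ENNReal.ofReal (Real.exp (-(L * t)) / 2)
      • (Measure.dirac (c * t) + Measure.dirac (-(c * t)))) :=
    Measure.smul_finite _ ENNReal.ofReal_ne_top
  unfold law
  infer_instance

lemma mgf_law (hc : 0 < c) (hL : 0 < L) (ht : 0 < t) (θ : ℝ) :
    mgf id (law c L t) θ = Real.exp (-(L * t)) * (Real.cosh (√(L ^ 2 + (θ * c) ^ 2) * t)
      + L / √(L ^ 2 + (θ * c) ^ 2) * Real.sinh (√(L ^ 2 + (θ * c) ^ 2) * t)) := by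
  have hR : 0 < c * t := mul_pos hc ht
  have hA : 0 < L * t := mul_pos hL ht
  have h1 : IntervalIntegrable (fun x ↦ density c L t x * Real.exp (θ * x)) volume
      (-(c * t)) (c * t) := by
    refine ContinuousOn.intervalIntegrable ?_
    rw [uIcc_of_le (by linarith)]
    exact (continuousOn_density hL ht).mul (by fun_prop)
  have h2 := integral_law hc hL ht h1
  have h3 : ∫ x in (-(c * t))..(c * t), density c L t x * Real.exp (θ * x)
      = Real.exp (-(L * t)) * (L / (2 * c) * ∫ x in (-(c * t))..(c * t),
        densitySeries L t ((c * t) ^ 2) x * Real.cosh (θ * x)) := by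
    rw [← integral_densitySeries_mul_exp hA.le hR.le, ← intervalIntegral.integral_const_mul,
      ← intervalIntegral.integral_const_mul]
    refine intervalIntegral.integral_congr fun x _ ↦ ?_
    simp only [density]
    ring
  have h4 : √((L * t) ^ 2 + (θ * (c * t)) ^ 2) = √(L ^ 2 + (θ * c) ^ 2) * t := by
    rw [show (L * t) ^ 2 + (θ * (c * t)) ^ 2 = (L ^ 2 + (θ * c) ^ 2) * t ^ 2 by ring,
      Real.sqrt_mul (by positivity), Real.sqrt_sq ht.le]
  have h5 : 0 < √(L ^ 2 + (θ * c) ^ 2) := Real.sqrt_pos.2 (by positivity)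
  rw [mgf]
  simp only [id_eq]
  rw [h2, h3, integral_densitySeries_mul_cosh hc ht hL, h4, Real.cosh_eq (θ * (c * t)), mul_neg,
    mul_div_mul_right _ _ ht.ne']
  ring

lemma IsTelegraphProcess.map_eq_law {Ω : Type*} [MeasurableSpace Ω] {P : Measure Ω}
    [IsProbabilityMeasure P] {lam : ℝ≥0} {X : ℝ≥0 → Ω → ℝ} (hX : IsTelegraphProcess P c lam X)
    (hc : 0 < c) (hlam : 0 < lam) {t : ℝ≥0} (ht : 0 < t) : P.map (X t) = law c lam t := by
  have hm := hX.aemeasurable t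
  have := isFiniteMeasure_law hc (NNReal.coe_pos.2 hlam) (NNReal.coe_pos.2 ht)
  have hmgf : mgf (X t) P = mgf id (law c lam t) := by
    ext θ
    rw [hX.mgf_eq hlam t θ, mgf_law hc (NNReal.coe_pos.2 hlam) (NNReal.coe_pos.2 ht)]
  have hset : integrableExpSet (X t) P = univ := by
    refine eq_univ_of_forall fun θ ↦ ?_
    refine .of_bound (Real.measurable_exp.comp_aemeasurable
      (hm.const_mul θ)).aestronglyMeasurable (Real.exp (|θ| * (c * t))) ?_
    filter_upwards [hX.ae_abs_le hc t] with ω hω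
    simpa using exp_mul_le_of_abs_le (θ := θ) hω
  -- Equality of the real transforms extends analytically to the strip over the interior of
  -- `integrableExpSet`, here the whole plane because X(t) is bounded.
  have h := eqOn_complexMGF_of_mgf hmgf
  have h' : complexMGF (X t) P = complexMGF id (law c lam t) := by
    ext z
    exact h (by simp [hset])
  simpa using Measure.ext_of_complexMGF_eq hm aemeasurable_id h'

end Law

/-! ### Masses of intervals -/

section Interval

variable {c L t : ℝ}

lemma intervalIntegrable_density (hL : 0 < L) (ht : 0 < t) {a b : ℝ}
    (ha : a ∈ Icc (-(c * t)) (c * t)) (hb : b ∈ Icc (-(c * t)) (c * t)) :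
    IntervalIntegrable (density c L t) volume a b :=
  ((continuousOn_density hL ht).mono (uIcc_subset_Icc ha hb)).intervalIntegrable

lemma integral_density_neg (a b : ℝ) :
    ∫ x in (-b)..(-a), density c L t x = ∫ x in a..b, density c L t x := by
  rw [← intervalIntegral.integral_comp_neg]
  simp_rw [density_neg]

lemma integral_density_mul_indicator (hc : 0 < c) (ht : 0 < t) {a b : ℝ}
    (ha : a ≤ c * t) (hb : -(c * t) ≤ b) (hab : a ≤ b) :
    ∫ x in (-(c * t))..(c * t), density c L t x * (Ioo a b).indicator 1 x
      = ∫ x in (max (-(c * t)) a)..(min (c * t) b), density c L t x := by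
  have hR : 0 < c * t := mul_pos hc ht
  have h (x : ℝ) : density c L t x * (Ioo a b).indicator 1 x
      = (Ioo a b).indicator (density c L t) x := by
    by_cases hx : x ∈ Ioo a b <;> simp [hx]
  simp_rw [h]
  rw [intervalIntegral.integral_of_le (by linarith), setIntegral_indicator measurableSet_Ioo,
    intervalIntegral.integral_of_le (max_le (le_min (by linarith) hb) (le_min ha hab)),
    ← Ioc_inter_Ioc]
  exact setIntegral_congr_set ((ae_eq_refl _).inter Ioo_ae_eq_Ioc)

lemma intervalIntegrable_density_mul (hc : 0 < c) (hL : 0 < L) (ht : 0 < t) {f : ℝ → ℝ} {C : ℝ}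
    (hf : Measurable f) (hfC : ∀ x, |f x| ≤ C) :
    IntervalIntegrable (fun x ↦ density c L t x * f x) volume (-(c * t)) (c * t) := by
  have hR : 0 < c * t := mul_pos hc ht
  have h := intervalIntegrable_density (c := c) hL ht (left_mem_Icc.2 (by linarith))
    (right_mem_Icc.2 (by linarith))
  rw [intervalIntegrable_iff] at h ⊢
  exact h.mul_bdd hf.aestronglyMeasurable (.of_forall hfC)

lemma abs_indicator_one_le (s : Set ℝ) (x : ℝ) : |s.indicator (1 : ℝ → ℝ) x| ≤ 1 := by
  by_cases hx : x ∈ s <;> simp [hx]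

lemma law_real_Ioo (hc : 0 < c) (hL : 0 < L) (ht : 0 < t) {a b : ℝ}
    (ha : a ≤ c * t) (hb : -(c * t) ≤ b) (hab : a ≤ b) :
    (law c L t).real (Ioo a b) = Real.exp (-(L * t)) / 2
        * ((Ioo a b).indicator 1 (c * t) + (Ioo a b).indicator 1 (-(c * t)))
      + ∫ x in (max (-(c * t)) a)..(min (c * t) b), density c L t x := by
  rw [← integral_density_mul_indicator hc ht ha hb hab, ← integral_law hc hL ht
    (intervalIntegrable_density_mul hc hL ht (measurable_one.indicator measurableSet_Ioo)
      (abs_indicator_one_le _)), integral_indicator_one measurableSet_Ioo]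

lemma integral_density_eq (hc : 0 < c) (hL : 0 < L) (ht : 0 < t) :
    ∫ x in (0 : ℝ)..(c * t), density c L t x = (1 - Real.exp (-(L * t))) / 2 := by
  have hR : 0 < c * t := mul_pos hc ht
  have hA : 0 < L * t := mul_pos hL ht
  -- The transform at θ = 0 gives the total continuous mass 1 - e^{-Lt}; evenness of the density
  -- halves it.
  have h1 := integral_densitySeries_mul_cosh hc ht hL 0
  simp only [zero_mul, Real.cosh_zero, mul_one, ne_eq, OfNat.ofNat_ne_zero, not_false_eq_true,
    zero_pow, add_zero, Real.sqrt_sq hA.le, div_self hA.ne', one_mul, Real.cosh_add_sinh] at h1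
  have h2 : ∫ x in (-(c * t))..(c * t), density c L t x = 1 - Real.exp (-(L * t)) := by
    simp only [density]
    rw [intervalIntegral.integral_const_mul, mul_div_right_comm, mul_comm _ (Real.exp _),
      mul_assoc, h1, mul_sub, ← Real.exp_add]
    simp
  have hm : (0 : ℝ) ∈ Icc (-(c * t)) (c * t) := ⟨by linarith, hR.le⟩
  have h3 := intervalIntegral.integral_add_adjacent_intervals
    (intervalIntegrable_density (c := c) hL ht (left_mem_Icc.2 (by linarith)) hm)
    (intervalIntegrable_density (c := c) hL ht hm (right_mem_Icc.2 (by linarith)))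
  have h4 := integral_density_neg (c := c) (L := L) (t := t) 0 (c * t)
  rw [neg_zero] at h4
  linarith

end Interval

/-! ### Termwise integration of the density -/

section Series

variable {c L t : ℝ}

lemma hasSum_coeff_mul_hypF (hL : 0 < L) (ht : 0 < t) {a b : ℝ}
    (ha : a ∈ Icc (-(c * t)) (c * t)) (hb : b ∈ Icc (-(c * t)) (c * t)) :
    HasSum (fun k ↦ coeff L t k * (b * hypF k (b ^ 2 / (c ^ 2 * t ^ 2))
      - a * hypF k (a ^ 2 / (c ^ 2 * t ^ 2)))) (∫ x in a..b, densitySeries L t ((c * t) ^ 2) x) := by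
  have hA : 0 ≤ L * t := (mul_pos hL ht).le
  have hsub : uIoc a b ⊆ Icc (-(c * t)) (c * t) := uIoc_subset_uIcc.trans (uIcc_subset_Icc ha hb)
  have key := intervalIntegral.hasSum_integral_of_dominated_convergence (μ := volume)
    (a := a) (b := b)
    (F := fun (k : ℕ) x ↦ coeff L t k * (1 - x ^ 2 / (c * t) ^ 2) ^ k)
    (f := densitySeries L t ((c * t) ^ 2)) (fun k _ ↦ coeff L t k)
    (fun k ↦ Continuous.aestronglyMeasurable (by fun_prop))
    (fun k ↦ .of_forall fun x hx ↦ norm_coeff_mul_le hA (hsub hx) k)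
    (.of_forall fun _ _ ↦ summable_coeff L t) intervalIntegrable_const
    (.of_forall fun x hx ↦ hasSum_densitySeries hA (hsub hx))
  refine key.congr_fun fun k ↦ ?_
  rw [intervalIntegral.integral_const_mul, integral_one_sub_pow, mul_pow]

lemma abs_mul_hypF_sub_le (k : ℕ) {R a b : ℝ} (ha : a ∈ Icc (-R) R) (hb : b ∈ Icc (-R) R) :
    |b * hypF k (b ^ 2 / R ^ 2) - a * hypF k (a ^ 2 / R ^ 2)| ≤ |b - a| := by
  rw [← integral_one_sub_pow]
  have := intervalIntegral.norm_integral_le_of_norm_le_const (C := 1) (a := a) (b := b)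
    (f := fun x ↦ (1 - x ^ 2 / R ^ 2) ^ k) fun x hx ↦ by
      have hm := one_sub_sq_div_mem (uIcc_subset_Icc ha hb (uIoc_subset_uIcc hx))
      rw [Real.norm_of_nonneg (pow_nonneg hm.1 k)]
      exact pow_le_one₀ hm.1 hm.2
  simpa using this

/-- F_k(x²/R²) is the mean of (1 - y²/R²)^k between 0 and x; at x = 0 it is 1. -/
lemma abs_hypF_le_one (k : ℕ) {R x : ℝ} (hx : x ∈ Icc (-R) R) : |hypF k (x ^ 2 / R ^ 2)| ≤ 1 := by
  by_cases h : x = 0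
  · simp [h, hypF]
  · have h0 : (0 : ℝ) ∈ Icc (-R) R := by
      constructor <;> linarith [hx.1, hx.2]
    have := abs_mul_hypF_sub_le k h0 hx
    rw [zero_mul, sub_zero, sub_zero, abs_mul] at this
    exact le_of_mul_le_mul_left (by simpa using this) (abs_pos.2 h)

lemma summable_coeff_mul_hypF (hL : 0 < L) (ht : 0 < t) {x : ℝ}
    (hx : x ∈ Icc (-(c * t)) (c * t)) :
    Summable fun k ↦ coeff L t k * hypF k (x ^ 2 / (c ^ 2 * t ^ 2)) := by
  have hA : 0 ≤ L * t := (mul_pos hL ht).le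
  refine Summable.of_norm_bounded (summable_coeff L t) fun k ↦ ?_
  rw [norm_mul, Real.norm_of_nonneg (coeff_nonneg hA k), ← mul_pow]
  exact mul_le_of_le_one_right (coeff_nonneg hA k) (abs_hypF_le_one k hx)

/-- The left side is the integral of the density from 0 to x, hence half the continuous mass minus
the tail beyond x. This is how the tails turn into the single series of Q. -/
lemma mul_tsum_coeff_mul_hypF (hc : 0 < c) (hL : 0 < L) (ht : 0 < t) {x : ℝ}
    (hx : x ∈ Icc (-(c * t)) (c * t)) :
    L * Real.exp (-(L * t)) / (2 * c)
        * (x * ∑' k, coeff L t k * hypF k (x ^ 2 / (c ^ 2 * t ^ 2)))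
      = (1 - Real.exp (-(L * t))) / 2 - ∫ y in x..(c * t), density c L t y := by
  have hR : 0 < c * t := mul_pos hc ht
  have h0 : (0 : ℝ) ∈ Icc (-(c * t)) (c * t) := ⟨by linarith, hR.le⟩
  have h1 := (hasSum_coeff_mul_hypF hL ht h0 hx).tsum_eq
  simp only [zero_mul, sub_zero] at h1
  have h2 : ∫ y in (0 : ℝ)..x, density c L t y = L * Real.exp (-(L * t)) / (2 * c)
      * (x * ∑' k, coeff L t k * hypF k (x ^ 2 / (c ^ 2 * t ^ 2))) := by
    simp only [density]
    rw [intervalIntegral.integral_const_mul, ← h1, ← tsum_mul_left (a := x)]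
    congr 2
    ext k
    ring
  rw [← h2, ← integral_density_eq hc hL ht, eq_sub_iff_add_eq]
  exact intervalIntegral.integral_add_adjacent_intervals (intervalIntegrable_density hL ht h0 hx)
    (intervalIntegrable_density hL ht hx (right_mem_Icc.2 (by linarith)))

end Series

/-! ### The contribution of the two densities -/

section IntegralTerm

variable {c₁ c₂ L₁ L₂ t r : ℝ}

lemma alpha_mem (hc₂ : 0 < c₂) (hc : c₂ < c₁) (ht : 0 < t) (hr : 0 < r) {y : ℝ}
    (hy : y ∈ Icc (-(c₂ * t)) (c₂ * t)) : alpha c₁ t y r ∈ Icc (-(c₁ * t)) (c₁ * t) := by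
  have h1 : c₂ * t < c₁ * t := mul_lt_mul_of_pos_right hc ht
  have h2 : 0 < c₂ * t := mul_pos hc₂ ht
  exact ⟨le_max_left _ _, max_le (by linarith) (by linarith [hy.2])⟩

lemma beta_mem (hc₂ : 0 < c₂) (hc : c₂ < c₁) (ht : 0 < t) (hr : 0 < r) {y : ℝ}
    (hy : y ∈ Icc (-(c₂ * t)) (c₂ * t)) : beta c₁ t y r ∈ Icc (-(c₁ * t)) (c₁ * t) := by
  have h1 : c₂ * t < c₁ * t := mul_lt_mul_of_pos_right hc ht
  have h2 : 0 < c₂ * t := mul_pos hc₂ ht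
  exact ⟨le_min (by linarith) (by linarith [hy.1]), min_le_left _ _⟩

/-- The first factor of the integrand of the integral term. -/
noncomputable def kernelI (c₁ t r : ℝ) (k : ℕ) (y : ℝ) : ℝ :=
  beta c₁ t y r * hypF k (beta c₁ t y r ^ 2 / (c₁ ^ 2 * t ^ 2))
    - alpha c₁ t y r * hypF k (alpha c₁ t y r ^ 2 / (c₁ ^ 2 * t ^ 2))

lemma continuous_kernelI (c₁ t r : ℝ) (k : ℕ) : Continuous (kernelI c₁ t r k) := by
  have h := continuous_mul_hypF k (c₁ ^ 2 * t ^ 2)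
  have hb : Continuous fun y ↦ beta c₁ t y r := by unfold beta; fun_prop
  have ha : Continuous fun y ↦ alpha c₁ t y r := by unfold alpha; fun_prop
  exact (h.comp hb).sub (h.comp ha)

lemma abs_kernelI_le (hc₂ : 0 < c₂) (hc : c₂ < c₁) (ht : 0 < t) (hr : 0 < r) {y : ℝ}
    (hy : y ∈ Icc (-(c₂ * t)) (c₂ * t)) (k : ℕ) : |kernelI c₁ t r k y| ≤ 2 * (c₁ * t) := by
  have ha := alpha_mem hc₂ hc ht hr hy
  have hb := beta_mem hc₂ hc ht hr hy
  rw [kernelI, ← mul_pow]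
  refine (abs_mul_hypF_sub_le k ha hb).trans ?_
  rw [abs_le]
  constructor <;> linarith [ha.1, ha.2, hb.1, hb.2]

lemma integrandI_eq (hc₂ : 0 < c₂) (ht : 0 < t) (k : ℕ) :
    EqOn (integrandI c₁ c₂ L₂ k r t)
      (fun y ↦ densitySeries L₂ t ((c₂ * t) ^ 2) y * kernelI c₁ t r k y)
      (Ioo (-(c₂ * t)) (c₂ * t)) := fun y hy ↦ by
  simp only [integrandI, besselI_add_besselI_eq hc₂ ht hy, kernelI, mul_pow]
  ring

lemma intervalIntegrable_integrandI (hc₂ : 0 < c₂) (hL₂ : 0 < L₂) (ht : 0 < t) (k : ℕ) :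
    IntervalIntegrable (integrandI c₁ c₂ L₂ k r t) volume (-(c₂ * t)) (c₂ * t) := by
  have hR : 0 < c₂ * t := mul_pos hc₂ ht
  have h := intervalIntegrable_densitySeries_mul (L := L₂) (t := t) (by positivity) hR.le
    (continuous_kernelI c₁ t r k).continuousOn
  rw [intervalIntegrable_iff_integrableOn_Ioo_of_le (by linarith)] at h ⊢
  exact h.congr_fun (integrandI_eq hc₂ ht k).symm measurableSet_Ioo

lemma integralI_eq (hc₂ : 0 < c₂) (ht : 0 < t) (k : ℕ) :
    integralI c₁ c₂ L₂ k r t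
      = ∫ y in (-(c₂ * t))..(c₂ * t), density c₂ L₂ t y * kernelI c₁ t r k y := by
  have hR : 0 < c₂ * t := mul_pos hc₂ ht
  rw [integralI, ← intervalIntegral.integral_const_mul,
    intervalIntegral.integral_of_le (by linarith), intervalIntegral.integral_of_le (by linarith),
    integral_Ioc_eq_integral_Ioo, integral_Ioc_eq_integral_Ioo]
  refine setIntegral_congr_fun measurableSet_Ioo fun y hy ↦ ?_
  simp only [integrandI_eq hc₂ ht k hy, density]
  ring

/-- The factor with α and β is at most β - α ≤ 2c₁t in absolute value for every k, so the summable
`coeff` dominates and sum and integral may be exchanged. -/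
lemma hasSum_termI (hc₂ : 0 < c₂) (hc : c₂ < c₁) (hL₁ : 0 < L₁) (hL₂ : 0 < L₂) (ht : 0 < t)
    (hr : 0 < r) :
    HasSum (termI c₁ c₂ L₁ L₂ r t) (∫ y in (-(c₂ * t))..(c₂ * t), density c₂ L₂ t y
      * ∫ x in (alpha c₁ t y r)..(beta c₁ t y r), densitySeries L₁ t ((c₁ * t) ^ 2) x) := by
  have hR : 0 < c₂ * t := mul_pos hc₂ ht
  have hA : 0 ≤ L₁ * t := (mul_pos hL₁ ht).le
  have hle : -(c₂ * t) ≤ c₂ * t := by linarith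
  have hsub (y : ℝ) (hy : y ∈ uIoc (-(c₂ * t)) (c₂ * t)) : y ∈ Icc (-(c₂ * t)) (c₂ * t) :=
    Ioc_subset_Icc_self (uIoc_of_le hle ▸ hy)
  have hcont := (continuousOn_density (c := c₂) hL₂ ht)
  have key := intervalIntegral.hasSum_integral_of_dominated_convergence (μ := volume)
    (a := -(c₂ * t)) (b := c₂ * t)
    (F := fun (k : ℕ) y ↦ density c₂ L₂ t y * (coeff L₁ t k * kernelI c₁ t r k y))
    (f := fun y ↦ density c₂ L₂ t y
      * ∫ x in (alpha c₁ t y r)..(beta c₁ t y r), densitySeries L₁ t ((c₁ * t) ^ 2) x)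
    (fun k y ↦ coeff L₁ t k * (2 * (c₁ * t) * density c₂ L₂ t y))
    (fun k ↦ by
      rw [uIoc_of_le hle]
      exact ((hcont.mul ((continuous_kernelI c₁ t r k).const_mul
        (coeff L₁ t k)).continuousOn).mono Ioc_subset_Icc_self).aestronglyMeasurable
          measurableSet_Ioc)
    (fun k ↦ .of_forall fun y hy ↦ by
      have h1 := density_nonneg hc₂ hL₂ ht (hsub y hy)
      have h2 := coeff_nonneg hA k
      rw [norm_mul, norm_mul, Real.norm_of_nonneg h1, Real.norm_of_nonneg h2, Real.norm_eq_abs]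
      have h3 := mul_le_mul_of_nonneg_left (abs_kernelI_le hc₂ hc ht hr (hsub y hy) k)
        (mul_nonneg h1 h2)
      linarith)
    (.of_forall fun _ _ ↦ (summable_coeff L₁ t).mul_right _)
    (by
      simp_rw [tsum_mul_right]
      refine ContinuousOn.intervalIntegrable ?_
      rw [uIcc_of_le hle]
      exact continuousOn_const.mul (continuousOn_const.mul hcont))
    (.of_forall fun y hy ↦ (hasSum_coeff_mul_hypF hL₁ ht (alpha_mem hc₂ hc ht hr (hsub y hy))
      (beta_mem hc₂ hc ht hr (hsub y hy))).mul_left _)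
  refine key.congr_fun fun k ↦ ?_
  rw [termI, integralI_eq hc₂ ht, ← intervalIntegral.integral_const_mul]
  refine intervalIntegral.integral_congr fun y _ ↦ ?_
  ring

end IntegralTerm

/-! ### Fubini and the two regimes of r -/

section Distance

lemma preimage_abs_sub_lt (r y : ℝ) :
    (fun x ↦ (x, y)) ⁻¹' {p : ℝ × ℝ | |p.1 - p.2| < r} = Ioo (y - r) (y + r) := by
  ext x
  simp only [mem_preimage, mem_ofPred_eq, mem_Ioo, abs_sub_lt_iff]
  constructor <;> rintro ⟨h1, h2⟩ <;> constructor <;> linarith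

lemma measurableSet_abs_sub_lt (r : ℝ) : MeasurableSet {p : ℝ × ℝ | |p.1 - p.2| < r} :=
  (isOpen_lt (by fun_prop) continuous_const).measurableSet

lemma measurable_measure_Ioo (μ : Measure ℝ) [SFinite μ] (r : ℝ) :
    Measurable fun y ↦ μ (Ioo (y - r) (y + r)) := by
  simp_rw [← preimage_abs_sub_lt]
  exact measurable_measure_prodMk_right (measurableSet_abs_sub_lt r)

lemma prod_real_abs_sub_lt (μ ν : Measure ℝ) [IsFiniteMeasure μ] [IsFiniteMeasure ν] (r : ℝ) :
    (μ.prod ν).real {p : ℝ × ℝ | |p.1 - p.2| < r} = ∫ y, μ.real (Ioo (y - r) (y + r)) ∂ν := by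
  rw [measureReal_def, Measure.prod_apply_symm (measurableSet_abs_sub_lt r)]
  simp_rw [preimage_abs_sub_lt]
  exact (integral_toReal (measurable_measure_Ioo μ r).aemeasurable
    (.of_forall fun y ↦ measure_lt_top _ _)).symm

variable {c₁ c₂ : ℝ}

lemma distanceDF_eq_integral {Ω : Type*} [MeasurableSpace Ω] {P : Measure Ω}
    [IsProbabilityMeasure P] {lam₁ lam₂ : ℝ≥0} (hc₁ : 0 < c₁) (hc₂ : 0 < c₂) (hlam₁ : 0 < lam₁)
    (hlam₂ : 0 < lam₂) {X₁ X₂ : ℝ≥0 → Ω → ℝ} (hX₁ : IsTelegraphProcess P c₁ lam₁ X₁)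
    (hX₂ : IsTelegraphProcess P c₂ lam₂ X₂)
    (hindep : IndepFun (fun ω s ↦ X₁ s ω) (fun ω s ↦ X₂ s ω) P) {t : ℝ≥0} (ht : 0 < t) (r : ℝ) :
    distanceDF P X₁ X₂ r t
      = ∫ y, (law c₁ lam₁ t).real (Ioo (y - r) (y + r)) ∂law c₂ lam₂ t := by
  have := isFiniteMeasure_law hc₁ (NNReal.coe_pos.2 hlam₁) (NNReal.coe_pos.2 ht)
  have := isFiniteMeasure_law hc₂ (NNReal.coe_pos.2 hlam₂) (NNReal.coe_pos.2 ht)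
  have h1 : IndepFun (X₁ t) (X₂ t) P :=
    hindep.comp (measurable_pi_apply t) (measurable_pi_apply t)
  have hm₁ := hX₁.aemeasurable t
  have hm₂ := hX₂.aemeasurable t
  have h2 := (indepFun_iff_map_prod_eq_prod_map_map hm₁ hm₂).1 h1
  rw [hX₁.map_eq_law hc₁ hlam₁ ht, hX₂.map_eq_law hc₂ hlam₂ ht] at h2
  rw [← prod_real_abs_sub_lt, ← h2, map_measureReal_apply_of_aemeasurable (hm₁.prodMk hm₂)
    (measurableSet_abs_sub_lt r)]
  rfl

variable {L₁ L₂ t r : ℝ}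

/-- An atom a lies within r of y exactly when y lies within r of a, so the atomic part becomes a
function of y ready to be integrated; the clipped endpoints are α and β. -/
lemma law_real_Ioo_eq (hc₂ : 0 < c₂) (hc : c₂ < c₁) (hL₁ : 0 < L₁) (ht : 0 < t) (hr : 0 < r)
    {y : ℝ} (hy : y ∈ Icc (-(c₂ * t)) (c₂ * t)) :
    (law c₁ L₁ t).real (Ioo (y - r) (y + r)) = Real.exp (-(L₁ * t)) / 2
        * ((Ioo (c₁ * t - r) (c₁ * t + r)).indicator 1 y
          + (Ioo (-(c₁ * t) - r) (-(c₁ * t) + r)).indicator 1 y)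
      + ∫ x in (alpha c₁ t y r)..(beta c₁ t y r), density c₁ L₁ t x := by
  have h1 : c₂ * t < c₁ * t := mul_lt_mul_of_pos_right hc ht
  have hmem (a : ℝ) : (Ioo (y - r) (y + r)).indicator (1 : ℝ → ℝ) a
      = (Ioo (a - r) (a + r)).indicator 1 y := by
    have : a ∈ Ioo (y - r) (y + r) ↔ y ∈ Ioo (a - r) (a + r) := by
      constructor <;> rintro ⟨h1, h2⟩ <;> constructor <;> linarith
    by_cases h : a ∈ Ioo (y - r) (y + r)
    · rw [indicator_of_mem h, indicator_of_mem (this.1 h)]; rfl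
    · rw [indicator_of_notMem h, indicator_of_notMem (mt this.2 h)]
  rw [law_real_Ioo (hc₂.trans hc) hL₁ ht (by linarith [hy.2]) (by linarith [hy.1]) (by linarith),
    hmem, hmem]
  rfl

/-- Three contributions: atoms of the second law against the whole first law, density of the second
against atoms of the first, and density against density, which is the series of the `termI`. -/
lemma integral_law_real_Ioo (hc₂ : 0 < c₂) (hc : c₂ < c₁) (hL₁ : 0 < L₁) (hL₂ : 0 < L₂)
    (ht : 0 < t) (hr : 0 < r) :
    ∫ y, (law c₁ L₁ t).real (Ioo (y - r) (y + r)) ∂law c₂ L₂ t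
      = Real.exp (-(L₂ * t)) / 2 * ((law c₁ L₁ t).real (Ioo (c₂ * t - r) (c₂ * t + r))
          + (law c₁ L₁ t).real (Ioo (-(c₂ * t) - r) (-(c₂ * t) + r)))
        + Real.exp (-(L₁ * t)) / 2
          * ((∫ y in (-(c₂ * t))..(c₂ * t),
              density c₂ L₂ t y * (Ioo (c₁ * t - r) (c₁ * t + r)).indicator 1 y)
            + ∫ y in (-(c₂ * t))..(c₂ * t),
              density c₂ L₂ t y * (Ioo (-(c₁ * t) - r) (-(c₁ * t) + r)).indicator 1 y)
        + L₁ * Real.exp (-(L₁ * t)) / (2 * c₁) * ∑' k, termI c₁ c₂ L₁ L₂ r t k := by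
  have hR : 0 < c₂ * t := mul_pos hc₂ ht
  have := isFiniteMeasure_law (hc₂.trans hc) hL₁ ht
  have hint := intervalIntegrable_density_mul hc₂ hL₂ ht
    (f := fun y ↦ (law c₁ L₁ t).real (Ioo (y - r) (y + r)))
    (measurable_measure_Ioo (law c₁ L₁ t) r).ennreal_toReal
    (C := (law c₁ L₁ t).real univ) fun y ↦ by
      rw [abs_of_nonneg measureReal_nonneg]
      exact measureReal_mono (subset_univ _)
  have hind (a b : ℝ) := intervalIntegrable_density_mul hc₂ hL₂ ht
    (f := (Ioo a b).indicator 1) (measurable_one.indicator measurableSet_Ioo)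
    (abs_indicator_one_le _)
  rw [integral_law hc₂ hL₂ ht hint, (hasSum_termI hc₂ hc hL₁ hL₂ ht hr).tsum_eq, add_assoc]
  congr 1
  rw [← intervalIntegral.integral_add (hind _ _) (hind _ _),
    ← intervalIntegral.integral_const_mul, ← intervalIntegral.integral_const_mul,
    ← sub_eq_iff_eq_add', ← intervalIntegral.integral_sub hint
      (((hind _ _).add (hind _ _)).const_mul _)]
  refine intervalIntegral.integral_congr fun y hy ↦ ?_
  rw [uIcc_of_le (by linarith)] at hy
  have h := law_real_Ioo_eq hc₂ hc hL₁ ht hr hy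
  simp only [h]
  simp only [density, intervalIntegral.integral_const_mul]
  ring

lemma density_mul_indicator_integral_eq_zero (hc₂ : 0 < c₂) (ht : 0 < t) {a b : ℝ}
    (h : c₂ * t ≤ a ∨ b ≤ -(c₂ * t)) :
    ∫ y in (-(c₂ * t))..(c₂ * t), density c₂ L₂ t y * (Ioo a b).indicator 1 y = 0 := by
  have hR : 0 < c₂ * t := mul_pos hc₂ ht
  rw [intervalIntegral.integral_congr (g := fun _ ↦ 0), intervalIntegral.integral_zero]
  intro y hy
  rw [uIcc_of_le (by linarith)] at hy
  have : y ∉ Ioo a b := fun hy' ↦ by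
    rcases h with h | h
    · linarith [hy.2, hy'.1]
    · linarith [hy.1, hy'.2]
  simp [this]

/-- Here the windows around ±c₂t stay inside [-c₁t, c₁t] and miss its endpoints, being open; the two
windows have equal mass by evenness. -/
lemma integral_law_real_Ioo_eq_G (hc₂ : 0 < c₂) (hc : c₂ < c₁) (hL₁ : 0 < L₁) (hL₂ : 0 < L₂)
    (ht : 0 < t) (hr : 0 < r) (hr' : r ≤ (c₁ - c₂) * t) :
    ∫ y, (law c₁ L₁ t).real (Ioo (y - r) (y + r)) ∂law c₂ L₂ t = G c₁ c₂ L₁ L₂ r t := by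
  have hR : 0 < c₂ * t := mul_pos hc₂ ht
  rw [sub_mul] at hr'
  have ha : c₂ * t - r ∈ Icc (-(c₁ * t)) (c₁ * t) := by constructor <;> linarith
  have hb : c₂ * t + r ∈ Icc (-(c₁ * t)) (c₁ * t) := by constructor <;> linarith
  have e1 : (law c₁ L₁ t).real (Ioo (c₂ * t - r) (c₂ * t + r))
      = ∫ x in (c₂ * t - r)..(c₂ * t + r), density c₁ L₁ t x := by
    rw [law_real_Ioo (hc₂.trans hc) hL₁ ht (by linarith) (by linarith) (by linarith),
      max_eq_right ha.1, min_eq_right hb.2, indicator_of_notMem, indicator_of_notMem]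
    · simp
    · exact fun h ↦ by linarith [h.1]
    · exact fun h ↦ by linarith [h.2]
  have e2 : (law c₁ L₁ t).real (Ioo (-(c₂ * t) - r) (-(c₂ * t) + r))
      = ∫ x in (c₂ * t - r)..(c₂ * t + r), density c₁ L₁ t x := by
    rw [law_real_Ioo (hc₂.trans hc) hL₁ ht (by linarith) (by linarith) (by linarith),
      max_eq_right (by linarith), min_eq_right (by linarith), indicator_of_notMem,
      indicator_of_notMem, ← integral_density_neg]
    · ring_nf
    · exact fun h ↦ by linarith [h.1]
    · exact fun h ↦ by linarith [h.2]
  have e3 : ∫ x in (c₂ * t - r)..(c₂ * t + r), density c₁ L₁ t x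
      = L₁ * Real.exp (-(L₁ * t)) / (2 * c₁) * ∑' k, termG c₁ c₂ L₁ r t k := by
    simp only [density]
    rw [intervalIntegral.integral_const_mul, ← (hasSum_coeff_mul_hypF hL₁ ht ha hb).tsum_eq]
    rfl
  rw [integral_law_real_Ioo hc₂ hc hL₁ hL₂ ht hr, e1, e2, e3,
    density_mul_indicator_integral_eq_zero hc₂ ht (.inl (by linarith)),
    density_mul_indicator_integral_eq_zero hc₂ ht (.inr (by linarith)), G,
    show -((L₁ + L₂) * t) = -(L₁ * t) + -(L₂ * t) by ring, Real.exp_add]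
  ring

/-- Each window around ±c₂t now contains the atom of the first law on its own side, and not the
opposite one. By evenness all continuous parts reduce to the tails beyond c₂t - r for the first
density and c₁t - r for the second. -/
lemma integral_law_real_Ioo_eq_Q (hc₂ : 0 < c₂) (hc : c₂ < c₁) (hL₁ : 0 < L₁) (hL₂ : 0 < L₂)
    (ht : 0 < t) (hr : (c₁ - c₂) * t < r) (hr' : r ≤ (c₁ + c₂) * t) :
    ∫ y, (law c₁ L₁ t).real (Ioo (y - r) (y + r)) ∂law c₂ L₂ t = Q c₁ c₂ L₁ L₂ r t := by
  have hR : 0 < c₂ * t := mul_pos hc₂ ht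
  have hR₁ : c₂ * t < c₁ * t := mul_lt_mul_of_pos_right hc ht
  rw [sub_mul] at hr
  rw [add_mul] at hr'
  have hr0 : 0 < r := by linarith
  have hc₁ := hc₂.trans hc
  have ha : c₂ * t - r ∈ Icc (-(c₁ * t)) (c₁ * t) := by constructor <;> linarith
  have hb : c₁ * t - r ∈ Icc (-(c₂ * t)) (c₂ * t) := by constructor <;> linarith
  have e1 : (law c₁ L₁ t).real (Ioo (c₂ * t - r) (c₂ * t + r)) = Real.exp (-(L₁ * t)) / 2
      + ∫ x in (c₂ * t - r)..(c₁ * t), density c₁ L₁ t x := by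
    rw [law_real_Ioo hc₁ hL₁ ht (by linarith) (by linarith) (by linarith),
      max_eq_right ha.1, min_eq_left (by linarith), indicator_of_mem, indicator_of_notMem]
    · simp
    · exact fun h ↦ by linarith [h.1, ha.1]
    · constructor <;> linarith
  have e2 : (law c₁ L₁ t).real (Ioo (-(c₂ * t) - r) (-(c₂ * t) + r)) = Real.exp (-(L₁ * t)) / 2
      + ∫ x in (c₂ * t - r)..(c₁ * t), density c₁ L₁ t x := by
    rw [law_real_Ioo hc₁ hL₁ ht (by linarith) (by linarith) (by linarith),
      max_eq_left (by linarith), min_eq_right (by linarith), indicator_of_notMem,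
      indicator_of_mem, ← integral_density_neg (c₂ * t - r)]
    · simp only [Pi.one_apply]
      ring_nf
    · constructor <;> linarith
    · exact fun h ↦ by linarith [h.2, ha.1]
  have e3 : ∫ y in (-(c₂ * t))..(c₂ * t),
      density c₂ L₂ t y * (Ioo (c₁ * t - r) (c₁ * t + r)).indicator 1 y
      = ∫ y in (c₁ * t - r)..(c₂ * t), density c₂ L₂ t y := by
    rw [integral_density_mul_indicator hc₂ ht hb.2 (by linarith) (by linarith),
      max_eq_right hb.1, min_eq_left (by linarith)]
  have e4 : ∫ y in (-(c₂ * t))..(c₂ * t),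
      density c₂ L₂ t y * (Ioo (-(c₁ * t) - r) (-(c₁ * t) + r)).indicator 1 y
      = ∫ y in (c₁ * t - r)..(c₂ * t), density c₂ L₂ t y := by
    rw [integral_density_mul_indicator hc₂ ht (by linarith) (by linarith) (by linarith),
      max_eq_left (by linarith), min_eq_right (by linarith),
      ← integral_density_neg (c₁ * t - r)]
    ring_nf
  have e5 := mul_tsum_coeff_mul_hypF hc₁ hL₁ ht ha
  have e6 := mul_tsum_coeff_mul_hypF hc₂ hL₂ ht hb
  -- Solved for the tails, so that they can be substituted.
  rw [eq_sub_iff_add_eq, ← eq_sub_iff_add_eq'] at e5 e6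
  rw [integral_law_real_Ioo hc₂ hc hL₁ hL₂ ht hr0, e1, e2, e3, e4, e5, e6, Q,
    show -((L₁ + L₂) * t) = -(L₁ * t) + -(L₂ * t) by ring, Real.exp_add]
  simp only [termQ]
  ring

end Distance

end Telegraph

/-! ### The four ranges of r -/

theorem theorem1 {Ω : Type*} [MeasurableSpace Ω] (P : Measure Ω) [IsProbabilityMeasure P]
    (c₁ c₂ : ℝ) (lam₁ lam₂ : ℝ≥0) (hc₂ : 0 < c₂) (hc : c₂ < c₁)
    (hlam₁ : 0 < lam₁) (hlam₂ : 0 < lam₂)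
    (X₁ X₂ : ℝ≥0 → Ω → ℝ)
    (hX₁ : Telegraph.IsTelegraphProcess P c₁ lam₁ X₁)
    (hX₂ : Telegraph.IsTelegraphProcess P c₂ lam₂ X₂)
    (hindep : IndepFun (fun ω s ↦ X₁ s ω) (fun ω s ↦ X₂ s ω) P)
    (t : ℝ≥0) (ht : 0 < t) (r : ℝ) :
    (r ≤ 0 → Telegraph.distanceDF P X₁ X₂ r t = 0) ∧
    (0 < r → r ≤ (c₁ - c₂) * t →
      (∀ k, IntervalIntegrable (Telegraph.integrandI c₁ c₂ lam₂ k r t) volume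
        (-(c₂ * t)) (c₂ * t)) ∧
      Summable (Telegraph.termG c₁ c₂ lam₁ r t) ∧
      Summable (Telegraph.termI c₁ c₂ lam₁ lam₂ r t) ∧
      Telegraph.distanceDF P X₁ X₂ r t = Telegraph.G c₁ c₂ lam₁ lam₂ r t) ∧
    ((c₁ - c₂) * t < r → r ≤ (c₁ + c₂) * t →
      (∀ k, IntervalIntegrable (Telegraph.integrandI c₁ c₂ lam₂ k r t) volume
        (-(c₂ * t)) (c₂ * t)) ∧
      Summable (Telegraph.termQ c₁ c₂ lam₁ r t) ∧
      Summable (Telegraph.termQ c₂ c₁ lam₂ r t) ∧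
      Summable (Telegraph.termI c₁ c₂ lam₁ lam₂ r t) ∧
      Telegraph.distanceDF P X₁ X₂ r t = Telegraph.Q c₁ c₂ lam₁ lam₂ r t) ∧
    ((c₁ + c₂) * t < r → Telegraph.distanceDF P X₁ X₂ r t = 1) := by
  have hc₁ : 0 < c₁ := hc₂.trans hc
  have hL₁ : (0 : ℝ) < lam₁ := NNReal.coe_pos.2 hlam₁
  have hL₂ : (0 : ℝ) < lam₂ := NNReal.coe_pos.2 hlam₂
  have ht' : (0 : ℝ) < t := NNReal.coe_pos.2 ht
  have hR : 0 < c₂ * t := mul_pos hc₂ ht'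
  have hR₁ : c₂ * t < c₁ * t := mul_lt_mul_of_pos_right hc ht'
  have hdist := Telegraph.distanceDF_eq_integral hc₁ hc₂ hlam₁ hlam₂ hX₁ hX₂ hindep ht r
  refine ⟨fun hr ↦ ?_, fun hr hr' ↦ ?_, fun hr hr' ↦ ?_, fun hr ↦ ?_⟩
  · have : {ω | |X₁ t ω - X₂ t ω| < r} = ∅ :=
      Set.eq_empty_of_forall_notMem fun ω hω ↦ (hr.trans (abs_nonneg _)).not_gt hω
    rw [Telegraph.distanceDF, this, measureReal_empty]
  · have hr2 := hr'
    rw [sub_mul] at hr2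
    refine ⟨Telegraph.intervalIntegrable_integrandI hc₂ hL₂ ht',
      (Telegraph.hasSum_coeff_mul_hypF hL₁ ht' ?_ ?_).summable,
      (Telegraph.hasSum_termI hc₂ hc hL₁ hL₂ ht' hr).summable,
      hdist.trans (Telegraph.integral_law_real_Ioo_eq_G hc₂ hc hL₁ hL₂ ht' hr hr')⟩ <;>
    constructor <;> linarith
  · have hr1 := hr
    have hr2 := hr'
    rw [sub_mul] at hr1
    rw [add_mul] at hr2
    refine ⟨Telegraph.intervalIntegrable_integrandI hc₂ hL₂ ht',
      Telegraph.summable_coeff_mul_hypF hL₁ ht' ?_, Telegraph.summable_coeff_mul_hypF hL₂ ht' ?_,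
      (Telegraph.hasSum_termI hc₂ hc hL₁ hL₂ ht' (by linarith)).summable,
      hdist.trans (Telegraph.integral_law_real_Ioo_eq_Q hc₂ hc hL₁ hL₂ ht' hr hr')⟩ <;>
    constructor <;> linarith
  · have h : ∀ᵐ ω ∂P, ω ∈ {ω | |X₁ t ω - X₂ t ω| < r} := by
      filter_upwards [hX₁.ae_abs_le hc₁ t, hX₂.ae_abs_le hc₂ t] with ω h1 h2
      calc |X₁ t ω - X₂ t ω| ≤ |X₁ t ω| + |X₂ t ω| := abs_sub _ _
        _ ≤ (c₁ + c₂) * t := by rw [add_mul]; exact add_le_add h1 h2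
        _ < r := hr
    rw [Telegraph.distanceDF, measureReal_def, measure_eq_measure_of_null_sdiff
      (Set.subset_univ _) ?_]
    · simp
    · rw [← Set.compl_eq_univ_sdiff]
      exact h
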